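/- A partition of length $w$ is a nonincreasing sequence of integers $(y_1,\ldots,y_w)$; put $y_i=+\infty$ for $i\le 0$, $y_i=-\infty$ for $i>w$, and let empty sums be $0$. **Weak generalized majorization.** Let $\mathbf d=(d_1,\ldots,d_m)$, $\mathbf a=(a_1,\ldots,a_s)$, $\mathbf g=(g_1,\ldots,g_{m+s})$ be partitions and $h_j:=\min\{i\mid d_{i-j+1}<g_i\}$, $j=1,\ldots,s$. We write $\mathbf g\prec''(\mathbf d,\mathbf a)$ if $$d_i\ge g_{i+s}\ (1\le i\le m),\qquad \sum_{i=h_j+1}^{m+s}g_i\ge\sum_{i=h_j-j+1}^{m}d_i+\sum_{i=j+1}^{s}a_i\ (1\le j\le s),\qquad \sum_{i=1}^{m+s}g_i\ge\sum_{i=1}^{m}d_i+\sum_{i=1}^{s}a_i .$$ **Setting.** Let $m,n,s,k$ be nonnegative integers with $m+s=n+k$, and let $\mathbf a=(a_1,\ldots,a_s)$, $\mathbf d=(d_1,\ldots,d_m)$, $\mathbf b=(b_1,\ldots,b_k)$, $\mathbf c=(c_1,\ldots,c_n)$ be partitions with $c_i\ne d_j$ for all $i,j$. Let $\mathbf e=(e_1,\ldots,e_{m+s})$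 be the nonincreasing union of $\mathbf d$ and $\mathbf a$, in which entries of $\mathbf a$ precede the equal entries of $\mathbf d$, and let $\mathbf e'=(e'_1,\ldots,e'_{m+s})$ be the nonincreasing union of $\mathbf c$ and $\mathbf b$, in which entries of $\mathbf b$ precede the equal entries of $\mathbf c$. **The sets $S\subseteq\{1,\ldots,n\}$ and $\Delta\subseteq\{1,\ldots,m\}$.** Start with $S=\Delta=\emptyset$ and treat the elements of $\mathbf c$ and $\mathbf d$ one by one in nondecreasing order of value; among equal elements the one with the largest index is treated first. In each step $S$ and $\Delta$ denote the current sets. If the element treated is $d_j$, let $q_j:=s-\sharp\{i\in S\mid c_i<d_j\}+\sharp\{i>j\mid i\notin\Delta\}+1$. If $q_j>s$, put $j$ into $\Delta$. If $q_j\le s$, let $l\in S$ be the minimal index with $c_l<d_j$, and let $$N:=\sharp\{i\mid a_i>c_l\}-\bigl(s-\sharp\{i\in S\mid i>l\}+\sharp\{i\notin\Delta\mid d_i<c_l\}\bigr).$$ - (a) If $N\ge 0$ and $d_j$ is among the $N+1$ smallest of the $e_i$ that are bigger than $c_l$, then $j$ is left out of $\Delta$. - (b) Otherwise $j$ is left out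 of $\Delta$ if $\displaystyle\sum_{i\in S,\ c_i<d_j}c_i\ge\sum_{i\notin\Delta,\ i>j}d_i+d_j+\sum_{i=q_j+1}^{s}a_i$, and is put into $\Delta$ if this inequality fails. If the element treated is $c_j$, the dual rule, obtained by exchanging $(\mathbf d,\mathbf a,\mathbf e,\Delta,m,s)$ with $(\mathbf c,\mathbf b,\mathbf e',S,n,k)$, decides whether $j$ is put into $S$ or left out of it. **Associated integers.** For the final sets let $h=\sharp\Delta$, $h'=\sharp S$, let $d^1\ge\cdots\ge d^h$ be the $d_i$ with $i\in\Delta$ and $c^1\ge\cdots\ge c^{h'}$ the $c_i$ with $i\in S$. For $y=1,\ldots,h'$ put $$m_y:=\sharp\{i\mid a_i>c^y\},\quad t_y:=s-(h'-y)+\sharp\{i\notin\Delta\mid d_i<c^y\},\quad z_y:=\sharp\{i\mid d_i>c^y\},$$ and for $x=1,\ldots,h$ put $$m'_x:=\sharp\{i\mid b_i>d^x\},\quad t'_x:=k-(h-x)+\sharp\{i\notin S\mid c_i<d^x\},\quad z'_x:=\sharp\{i\mid c_i>d^x\}.$$ **Theorem.** There is a partition $\mathbf g=(g_1,\ldots,g_{m+s})$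 with $\mathbf g\prec''(\mathbf d,\mathbf a)$ and $\mathbf g\prec''(\mathbf c,\mathbf b)$ if and only if both of the following hold: (i) for every $y\in\{1,\ldots,h'\}$ with $t_y\le m_y$, $$\sum_{i=z_y+t_y}^{z_y+m_y}e_i\le\sum_{i=y}^{h'}c^i-\sum_{i\ge z_y+1,\ i\notin\Delta}d_i-\sum_{i=m_y+1}^{s}a_i;$$ (ii) for every $x\in\{1,\ldots,h\}$ with $t'_x\le m'_x$, $$\sum_{i=z'_x+t'_x}^{z'_x+m'_x}e'_i\le\sum_{i=x}^{h}d^i-\sum_{i\ge z'_x+1,\ i\notin S}c_i-\sum_{i=m'_x+1}^{k}b_i.$$ -/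

import Mathlib

open Finset

namespace GenMaj

/-- A partition `(y_1, …, y_w)` is a nonincreasing sequence of integers of length `w`.  It is
represented by a function on `ℕ` of which only the values at `1, …, w` are ever used. -/
def IsPartition (w : ℕ) (y : ℕ → ℤ) : Prop :=
  AntitoneOn y (Set.Icc 1 w)

/-- `h_j = min {i | d_{i-j+1} < g_i}`, where `d_i = +∞` for `i ≤ 0` and `d_i = -∞` for `i > m`.
The set contains `i = m + j`. -/
noncomputable def hIndex (m : ℕ) (d g : ℕ → ℤ) (j : ℕ) : ℕ :=
  sInf {i : ℕ | 1 ≤ i ∧ j ≤ i ∧ (m < i + 1 - j ∨ d (i + 1 - j) < g i)}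

/-- Weak generalized majorization `g ≺'' (d, a)` for `d = (d_1, …, d_m)`, `a = (a_1, …, a_s)` and
`g = (g_1, …, g_{m+s})`. -/
def WeakMaj (m s : ℕ) (g d a : ℕ → ℤ) : Prop :=
  (∀ i ∈ Icc 1 m, g (i + s) ≤ d i) ∧
  (∀ j ∈ Icc 1 s,
    ∑ i ∈ Icc (hIndex m d g j + 1 - j) m, d i + ∑ i ∈ Icc (j + 1) s, a i
      ≤ ∑ i ∈ Icc (hIndex m d g j + 1) (m + s), g i) ∧
  ∑ i ∈ Icc 1 m, d i + ∑ i ∈ Icc 1 s, a i ≤ ∑ i ∈ Icc 1 (m + s), g i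

/-! ### The union of two partitions -/

/-- The position of `a_i` in the union of `a = (a_1, …, a_s)` and `d = (d_1, …, d_m)`.  Entries of
`a` are placed before the equal entries of `d`. -/
def posFst (m : ℕ) (a d : ℕ → ℤ) (i : ℕ) : ℕ :=
  i + #{j ∈ Icc 1 m | a i < d j}

/-- The position of `d_j` in the union of `a = (a_1, …, a_s)` and `d = (d_1, …, d_m)`. -/
def posSnd (s : ℕ) (a d : ℕ → ℤ) (j : ℕ) : ℕ :=
  j + #{i ∈ Icc 1 s | d j ≤ a i}

/-- The union `e = (e_1, …, e_{m+s})` of the partitions `d` and `a`: its `p`-th entry is the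
entry of `a` or of `d` whose position is `p`.  (For partitions each sum below has at most one term, and for
`1 ≤ p ≤ m + s` exactly one of them has a term.) -/
def unionSeq (s m : ℕ) (a d : ℕ → ℤ) (p : ℕ) : ℤ :=
  ∑ i ∈ Icc 1 s with posFst m a d i = p, a i + ∑ j ∈ Icc 1 m with posSnd s a d j = p, d j

/-! ### The sets `S` and `Δ` -/

/-- `q_j = s - #{i ∈ S | c_i < d_j} + #{i > j | i ∉ Δ} + 1`. -/
def qIndex (s m : ℕ) (d c : ℕ → ℤ) (S Δ : Finset ℕ) (j : ℕ) : ℤ :=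
  (s : ℤ) - #{i ∈ S | c i < d j} + #{i ∈ Icc (j + 1) m | i ∉ Δ} + 1

/-- `#{i | a_i > c_l} - (s - #{i ∈ S | i > l} + #{i ∉ Δ | d_i < c_l})`. -/
def excess (s m : ℕ) (a d c : ℕ → ℤ) (S Δ : Finset ℕ) (l : ℕ) : ℤ :=
  (#{i ∈ Icc 1 s | c l < a i} : ℤ) -
    ((s : ℤ) - #{i ∈ S | l < i} + #{i ∈ Icc 1 m | i ∉ Δ ∧ d i < c l})

/-- Test (a) for `d_j`, where `l` is the minimal index in `S` with `c_l < d_j`: the excess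
`N` at `l` is nonnegative, and `d_j` is one of the `N + 1` smallest entries of `e` among those
that are bigger than `c_l`, i.e. at most `N + 1` of the entries of `e` from the position of `d_j`
on are bigger than `c_l`. -/
def TestA (s m : ℕ) (a d c : ℕ → ℤ) (S Δ : Finset ℕ) (j : ℕ) : Prop :=
  ∃ l ∈ S, (c l < d j ∧ ∀ i ∈ S, c i < d j → l ≤ i) ∧
    0 ≤ excess s m a d c S Δ l ∧
    (#{p ∈ Icc (posSnd s a d j) (m + s) | c l < unionSeq s m a d p} : ℤ)
      ≤ excess s m a d c S Δ l + 1

/-- Test (b) for `d_j`: the inequality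
`∑_{i ∈ S, c_i < d_j} c_i ≥ ∑_{i ∉ Δ, i > j} d_i + d_j + ∑_{i = q_j + 1}^s a_i`.
As `a_i = +∞` for `i ≤ 0`, it fails if `q_j < 0` (the test is only used if `q_j ≤ s`). -/
def TestB (s m : ℕ) (a d c : ℕ → ℤ) (S Δ : Finset ℕ) (j : ℕ) : Prop :=
  0 ≤ qIndex s m d c S Δ j ∧
  ∑ i ∈ Icc (j + 1) m with i ∉ Δ, d i + d j
      + ∑ i ∈ Icc ((qIndex s m d c S Δ j).toNat + 1) s, a i
    ≤ ∑ i ∈ S with c i < d j, c i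

/-- The index `j` of the chosen element `d_j` is left out of `Δ`. -/
def LeftOut (s m : ℕ) (a d c : ℕ → ℤ) (S Δ : Finset ℕ) (j : ℕ) : Prop :=
  qIndex s m d c S Δ j ≤ s ∧ (TestA s m a d c S Δ j ∨ TestB s m a d c S Δ j)

instance (s m : ℕ) (a d c : ℕ → ℤ) (S Δ : Finset ℕ) (j : ℕ) :
    Decidable (LeftOut s m a d c S Δ j) := by
  unfold LeftOut TestA TestB; infer_instance

/-- A stage of the construction: the elements `d_1, …, d_p` and `c_1, …, c_r` are still to be
treated, and `S`, `Δ` are the current sets. -/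
structure Stage where
  /-- the number of untreated elements of `d` -/
  p : ℕ
  /-- the number of untreated elements of `c` -/
  r : ℕ
  /-- the current set `S` -/
  S : Finset ℕ
  /-- the current set `Δ` -/
  Δ : Finset ℕ

/-- One step of the construction: the smallest untreated element (the one with the largest index,
if there are several) of the union of `c` and `d` is treated.  For an element of `c` the rule is
the dual one, obtained by exchanging `d, a, Δ, m, s` with `c, b, S, n, k`. -/
def step (m s n k : ℕ) (a d b c : ℕ → ℤ) (σ : Stage) : Stage :=
  if 0 < σ.p ∧ (σ.r = 0 ∨ d σ.p < c σ.r) then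
    { σ with
      p := σ.p - 1
      Δ := if LeftOut s m a d c σ.S σ.Δ σ.p then σ.Δ else insert σ.p σ.Δ }
  else if 0 < σ.r then
    { σ with
      r := σ.r - 1
      S := if LeftOut k n b c d σ.Δ σ.S σ.r then σ.S else insert σ.r σ.S }
  else σ

/-- The last stage: all `m + n` elements have been treated, starting from empty `S` and `Δ`. -/
def finalStage (m s n k : ℕ) (a d b c : ℕ → ℤ) : Stage :=
  (step m s n k a d b c)^[m + n] ⟨m, n, ∅, ∅⟩

/-- The set `S ⊆ {1, …, n}`. -/
def setS (m s n k : ℕ) (a d b c : ℕ → ℤ) : Finset ℕ := (finalStage m s n k a d b c).S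

/-- The set `Δ ⊆ {1, …, m}`. -/
def setΔ (m s n k : ℕ) (a d b c : ℕ → ℤ) : Finset ℕ := (finalStage m s n k a d b c).Δ

/-! ### The integers `m_y`, `t_y`, `z_y` and the inequalities -/

/-- The subsequence `c^1 ≥ ⋯ ≥ c^{h'}` of the `c_i` with `i ∈ S`, where `h' = #S`: `c^y = c_i`
for the `y`-th smallest element `i` of `S`. -/
noncomputable def sub (c : ℕ → ℤ) (S : Finset ℕ) (y : ℕ) : ℤ :=
  c (Nat.nth (· ∈ S) (y - 1))

/-- `m_y = #{i | a_i > c^y}`. -/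
noncomputable def mIndex (s : ℕ) (a c : ℕ → ℤ) (S : Finset ℕ) (y : ℕ) : ℕ :=
  #{i ∈ Icc 1 s | sub c S y < a i}

/-- `t_y = s - (h' - y) + #{i ∉ Δ | d_i < c^y}`. -/
noncomputable def tIndex (s m : ℕ) (d c : ℕ → ℤ) (S Δ : Finset ℕ) (y : ℕ) : ℤ :=
  (s : ℤ) - ((#S : ℤ) - y) + #{i ∈ Icc 1 m | i ∉ Δ ∧ d i < sub c S y}

/-- `z_y = #{i | d_i > c^y}`. -/
noncomputable def zIndex (m : ℕ) (d c : ℕ → ℤ) (S : Finset ℕ) (y : ℕ) : ℕ :=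
  #{i ∈ Icc 1 m | sub c S y < d i}

/-- The family of inequalities: for all `y ∈ {1, …, h'}` with `t_y ≤ m_y`,
`∑_{i = z_y + t_y}^{z_y + m_y} e_i
  ≤ ∑_{i = y}^{h'} c^i - ∑_{i ≥ z_y + 1, i ∉ Δ} d_i - ∑_{i = m_y + 1}^s a_i`.
As `e_i = +∞` for `i ≤ 0`, the inequality fails if `z_y + t_y < 1`. -/
def Inequalities (s m : ℕ) (a d c : ℕ → ℤ) (S Δ : Finset ℕ) : Prop :=
  ∀ y ∈ Icc 1 (#S), tIndex s m d c S Δ y ≤ mIndex s a c S y →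
    1 ≤ zIndex m d c S y + tIndex s m d c S Δ y ∧
    ∑ p ∈ Icc (zIndex m d c S y + tIndex s m d c S Δ y).toNat
        (zIndex m d c S y + mIndex s a c S y), unionSeq s m a d p
      ≤ ∑ i ∈ Icc y (#S), sub c S i
        - ∑ i ∈ Icc (zIndex m d c S y + 1) m with i ∉ Δ, d i
        - ∑ i ∈ Icc (mIndex s a c S y + 1) s, a i

end GenMaj

/-! The construction is a greedy choice of the last entries of g: the elements put into S or Δ
occupy the positions m+s, m+s-1, … one after another. When d_1, …, d_p and c_1, …, c_r are
untreated, let P = `pos p r` be the last free position and T = `total p r` the sum of the chosen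
elements. In these terms q_p = P - p + 1. Test (b) reads d_p + ∑_{i>p} d_i + ∑_{i>q_p} a_i ≤ T, and
tests (a) and (b) together amount to `Skip`: either this inequality holds with q_p ≤ s, or d_p
stands in e to the right of P (`leftOut_iff_skip`). Inequality (i) for c^y says that once c^y is
chosen, the tail of e beyond P has sum at most T (`inequality_iff`). So (i) and (ii) are `Bounded`
for the configuration and for its swap.

Necessity. For a majorized g, ∑_{i>P} g_i ≤ T at every stage. Indeed, if d_p is chosen but g_P >
d_p, then h_q ≤ P for q = P + 1 - p, and majorization bounds ∑_{i>P} g_i from below by d_p + ∑_{i>p}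
d_i + ∑_{i>q} a_i, so d_p would have been left out (`Run.le_of_not_skip`). The tail of e has the
least sum among all combinations of a tail of d and a tail of a with the same number of entries, so
it is at most the tail of g, hence at most T.

Sufficiency. Let G have the chosen elements in the occupied positions and a large constant B in the
free ones. Its tail beyond P has sum T, and `Bounded` yields that the tail of e is at most T at all
stages, because every choice not covered by the inequalities is at least the entry of e at its
position. This gives the majorization inequalities where e splits into initial segments of d and a.
At the other values of h_q they follow by moving from such a split to h_q, or from the decision
taken about d_j with j = h_q + 1 - q (`Fills.weakMaj`). -/

namespace GenMaj

/-! ### Tail sums and counting -/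

/-- The sum `y_{i+1} + ⋯ + y_w`. -/
def tailSum (w : ℕ) (y : ℕ → ℤ) (i : ℕ) : ℤ := ∑ x ∈ Ioc i w, y x

theorem sum_Icc_succ_eq_tailSum (w : ℕ) (y : ℕ → ℤ) (i : ℕ) :
    ∑ x ∈ Icc (i + 1) w, y x = tailSum w y i := by
  rw [tailSum]
  congr 1
  ext x
  simp

theorem tailSum_of_lt {w i : ℕ} (y : ℕ → ℤ) (h : i < w) :
    tailSum w y i = y (i + 1) + tailSum w y (i + 1) := by
  have : Ioc i w = insert (i + 1) (Ioc (i + 1) w) := by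
    ext x; simp only [mem_Ioc, mem_insert]; omega
  rw [tailSum, this, sum_insert (by simp), tailSum]

theorem tailSum_of_le {w i : ℕ} (y : ℕ → ℤ) (h : w ≤ i) : tailSum w y i = 0 := by
  rw [tailSum, Ioc_eq_empty_of_le h, sum_empty]

theorem add_tailSum_le {w i j : ℕ} {y : ℕ → ℤ} {v : ℤ} (hij : i ≤ j) (hjw : j ≤ w)
    (h : ∀ x, i < x → x ≤ j → v ≤ y x) :
    ((j : ℤ) - i) * v + tailSum w y j ≤ tailSum w y i := by
  induction j, hij using Nat.le_induction with
  | base => simp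
  | succ j hij ih =>
    have h1 := ih (by omega) fun x hx hx' => h x hx (by omega)
    have h2 := h (j + 1) (by omega) le_rfl
    rw [tailSum_of_lt y (by omega : j < w)] at h1
    push_cast
    linarith

theorem tailSum_le_add {w i j : ℕ} {y : ℕ → ℤ} {v : ℤ} (hij : i ≤ j) (hjw : j ≤ w)
    (h : ∀ x, i < x → x ≤ j → y x ≤ v) :
    tailSum w y i ≤ ((j : ℤ) - i) * v + tailSum w y j := by
  induction j, hij using Nat.le_induction with
  | base => simp
  | succ j hij ih =>
    have h1 := ih (by omega) fun x hx hx' => h x hx (by omega)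
    have h2 := h (j + 1) (by omega) le_rfl
    rw [tailSum_of_lt y (by omega : j < w)] at h1
    push_cast
    linarith

theorem IsPartition.le {w : ℕ} {y : ℕ → ℤ} (h : IsPartition w y) {i j : ℕ} (hi : 1 ≤ i)
    (hij : i ≤ j) (hj : j ≤ w) : y j ≤ y i :=
  h ⟨hi, hij.trans hj⟩ ⟨hi.trans hij, hj⟩ hij

theorem le_card_filter_Icc_iff {w x : ℕ} {P : ℕ → Prop} [DecidablePred P]
    (hP : ∀ i j, 1 ≤ i → i ≤ j → j ≤ w → P j → P i) (hx : 1 ≤ x) (hxw : x ≤ w) :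
    x ≤ #{i ∈ Icc 1 w | P i} ↔ P x := by
  constructor
  · intro h
    by_contra hn
    have : ({i ∈ Icc 1 w | P i} : Finset ℕ) ⊆ Icc 1 (x - 1) := by
      intro i hi
      simp only [mem_filter, mem_Icc] at hi ⊢
      refine ⟨hi.1.1, ?_⟩
      by_contra hlt
      exact hn (hP x i hx (by omega) hi.1.2 hi.2)
    have := card_le_card this
    simp at this
    omega
  · intro h
    have : Icc 1 x ⊆ ({i ∈ Icc 1 w | P i} : Finset ℕ) := by
      intro i hi
      simp only [mem_filter, mem_Icc] at hi ⊢
      exact ⟨⟨hi.1, hi.2.trans hxw⟩, hP i x hi.1 hi.2 hxw h⟩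
    have := card_le_card this
    simpa using this

theorem card_filter_Icc_le (w : ℕ) (P : ℕ → Prop) [DecidablePred P] :
    #{i ∈ Icc 1 w | P i} ≤ w := by
  simpa using card_filter_le (Icc 1 w) P

theorem IsPartition.le_card_lt_iff {w : ℕ} {y : ℕ → ℤ} (h : IsPartition w y) {x : ℕ} {v : ℤ}
    (hx : 1 ≤ x) (hxw : x ≤ w) : x ≤ #{i ∈ Icc 1 w | v < y i} ↔ v < y x :=
  le_card_filter_Icc_iff (fun _ _ hi hij hj hv => hv.trans_le (h.le hi hij hj)) hx hxw

theorem IsPartition.le_card_le_iff {w : ℕ} {y : ℕ → ℤ} (h : IsPartition w y) {x : ℕ} {v : ℤ}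
    (hx : 1 ≤ x) (hxw : x ≤ w) : x ≤ #{i ∈ Icc 1 w | v ≤ y i} ↔ v ≤ y x :=
  le_card_filter_Icc_iff (fun _ _ hi hij hj hv => hv.trans (h.le hi hij hj)) hx hxw

/-! ### The union of two partitions -/

/-- In the union of `a` and `d`, the first `x + r` entries are `d_1, …, d_x, a_1, …, a_r`. -/
def IsSplit (s m : ℕ) (a d : ℕ → ℤ) (x r : ℕ) : Prop :=
  x ≤ m ∧ r ≤ s ∧ (r = 0 ∨ x = m ∨ d (x + 1) ≤ a r) ∧ (x = 0 ∨ r = s ∨ a (r + 1) < d x)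

section Union

variable {s m : ℕ} {a d : ℕ → ℤ}

theorem IsSplit.succ (ha : IsPartition s a) (hd : IsPartition m d) {x r : ℕ}
    (h : IsSplit s m a d x r) (hlt : x + r < m + s) :
    (x < m ∧ (r = s ∨ a (r + 1) < d (x + 1)) ∧ IsSplit s m a d (x + 1) r) ∨
      (r < s ∧ (x = m ∨ d (x + 1) ≤ a (r + 1)) ∧ IsSplit s m a d x (r + 1)) := by
  obtain ⟨hx, hr, h1, h2⟩ := h
  by_cases hc : x < m ∧ (r = s ∨ a (r + 1) < d (x + 1))
  · refine Or.inl ⟨hc.1, hc.2, by omega, hr, ?_, ?_⟩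
    · rcases h1 with h1 | h1 | h1
      · exact Or.inl h1
      · omega
      · by_cases hm : x + 1 = m
        · exact Or.inr (Or.inl hm)
        · exact Or.inr (Or.inr ((hd.le (by omega) (by omega) (by omega)).trans h1))
    · exact Or.inr hc.2
  · have hrs : r < s := by
      by_contra hrs
      exact hc ⟨by omega, Or.inl (by omega)⟩
    have hd' : x = m ∨ d (x + 1) ≤ a (r + 1) := by
      by_cases hm : x = m
      · exact Or.inl hm
      · right
        by_contra hlt'
        exact hc ⟨by omega, Or.inr (by omega)⟩
    refine Or.inr ⟨hrs, hd', hx, by omega, Or.inr hd', ?_⟩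
    rcases h2 with h2 | h2 | h2
    · exact Or.inl h2
    · omega
    · by_cases hm : r + 1 = s
      · exact Or.inr (Or.inl hm)
      · exact Or.inr (Or.inr ((ha.le (by omega) (by omega) (by omega)).trans_lt h2))

theorem exists_isSplit (ha : IsPartition s a) (hd : IsPartition m d) {p : ℕ} (hp : p ≤ m + s) :
    ∃ x r, x + r = p ∧ IsSplit s m a d x r := by
  induction p with
  | zero => exact ⟨0, 0, rfl, by simp [IsSplit]⟩
  | succ p ih =>
    obtain ⟨x, r, rfl, h⟩ := ih (by omega)
    rcases h.succ ha hd (by omega) with ⟨-, -, h⟩ | ⟨-, -, h⟩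
    · exact ⟨x + 1, r, by omega, h⟩
    · exact ⟨x, r + 1, by omega, h⟩

/-- At a split, the positions beyond x + r are exactly those of d_{x+1}, …, d_m and a_{r+1}, …, a_s.
All later facts about the union are drawn from its tail sums at splits, not from the position
formulas. -/
theorem IsSplit.tailSum_unionSeq (ha : IsPartition s a) (hd : IsPartition m d) {x r : ℕ}
    (h : IsSplit s m a d x r) :
    tailSum (m + s) (unionSeq s m a d) (x + r) = tailSum m d x + tailSum s a r := by
  obtain ⟨hx, hr, h1, h2⟩ := h
  have hf : ∀ i ∈ Icc 1 s, posFst m a d i ∈ Ioc (x + r) (m + s) ↔ i ∈ Ioc r s := by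
    intro i hi
    rw [mem_Icc] at hi
    have hle := card_filter_Icc_le m fun j => a i < d j
    simp only [mem_Ioc, posFst]
    constructor
    · intro h
      refine ⟨?_, hi.2⟩
      by_contra hir
      have : x < m ∧ x + 1 ≤ #{j ∈ Icc 1 m | a i < d j} := by omega
      rw [hd.le_card_lt_iff (by omega) (by omega)] at this
      have h3 := ha.le hi.1 (by omega : i ≤ r) hr
      rcases h1 with h1 | h1 | h1 <;> omega
    · intro h
      refine ⟨?_, by omega⟩
      rcases Nat.eq_zero_or_pos x with h0 | h0
      · omega
      · have : x ≤ #{j ∈ Icc 1 m | a i < d j} := by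
          rw [hd.le_card_lt_iff (by omega) hx]
          have h3 := ha.le (by omega) (by omega : r + 1 ≤ i) hi.2
          rcases h2 with h2 | h2 | h2 <;> omega
        omega
  have hs : ∀ j ∈ Icc 1 m, posSnd s a d j ∈ Ioc (x + r) (m + s) ↔ j ∈ Ioc x m := by
    intro j hj
    rw [mem_Icc] at hj
    have hle := card_filter_Icc_le s fun i => d j ≤ a i
    simp only [mem_Ioc, posSnd]
    constructor
    · intro h
      refine ⟨?_, hj.2⟩
      by_contra hjx
      have : r < s ∧ r + 1 ≤ #{i ∈ Icc 1 s | d j ≤ a i} := by omega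
      rw [ha.le_card_le_iff (by omega) (by omega)] at this
      have h3 := hd.le hj.1 (by omega : j ≤ x) hx
      rcases h2 with h2 | h2 | h2 <;> omega
    · intro h
      refine ⟨?_, by omega⟩
      rcases Nat.eq_zero_or_pos r with h0 | h0
      · omega
      · have : r ≤ #{i ∈ Icc 1 s | d j ≤ a i} := by
          rw [ha.le_card_le_iff (by omega) hr]
          have h3 := hd.le (by omega) (by omega : x + 1 ≤ j) hj.2
          rcases h1 with h1 | h1 | h1 <;> omega
        omega
  have key : ∀ (w z : ℕ) (y : ℕ → ℤ) (f : ℕ → ℕ),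
      (∀ i ∈ Icc 1 w, f i ∈ Ioc (x + r) (m + s) ↔ i ∈ Ioc z w) →
      ∑ p ∈ Ioc (x + r) (m + s), ∑ i ∈ Icc 1 w with f i = p, y i = tailSum w y z := by
    intro w z y f hf
    rw [sum_fiberwise_eq_sum_filter, tailSum]
    refine sum_congr ?_ fun _ _ => rfl
    ext i
    rw [mem_filter]
    constructor
    · rintro ⟨hi, hi'⟩
      exact (hf i hi).1 hi'
    · intro hi
      have hi' : i ∈ Icc 1 w := by
        rw [mem_Ioc] at hi; rw [mem_Icc]; omega
      exact ⟨hi', (hf i hi').2 hi⟩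
  rw [tailSum]
  simp only [unionSeq]
  rw [sum_add_distrib, key s r a _ hf, key m x d _ hs, add_comm]

/-- An exchange argument: passing to the split (y, t) with y + t = x + r replaces a block of one
sequence by an equally long block of the other, and the split conditions make the new block no
larger. -/
theorem tailSum_unionSeq_le (ha : IsPartition s a) (hd : IsPartition m d) {x r : ℕ}
    (hx : x ≤ m) (hr : r ≤ s) :
    tailSum (m + s) (unionSeq s m a d) (x + r) ≤ tailSum m d x + tailSum s a r := by
  obtain ⟨y, t, hyt, h⟩ := exists_isSplit ha hd (by omega : x + r ≤ m + s)
  rw [← hyt, h.tailSum_unionSeq ha hd]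
  obtain ⟨hy, ht, h1, h2⟩ := h
  rcases lt_trichotomy x y with hlt | rfl | hlt
  · have e1 := add_tailSum_le (v := d y) hlt.le hy
      fun z hz hz' => hd.le (by omega) hz' hy
    have e2 := tailSum_le_add (v := a (t + 1)) (by omega : t ≤ r) hr
      fun z hz hz' => ha.le (by omega) (by omega : t + 1 ≤ z) (by omega)
    have e3 : a (t + 1) < d y := by rcases h2 with h2 | h2 | h2 <;> omega
    have e4 : (r : ℤ) - t = y - x := by omega
    rw [e4] at e2
    nlinarith
  · have : r = t := by omega
    rw [this]
  · have e1 := add_tailSum_le (v := a t) (by omega : r ≤ t) ht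
      fun z hz hz' => ha.le (by omega) hz' ht
    have e2 := tailSum_le_add (v := d (y + 1)) hlt.le hx
      fun z hz hz' => hd.le (by omega) (by omega : y + 1 ≤ z) (by omega)
    have e3 : d (y + 1) ≤ a t := by rcases h1 with h1 | h1 | h1 <;> omega
    have e4 : (t : ℤ) - r = x - y := by omega
    rw [e4] at e1
    nlinarith

/-- An entry of the union is the difference of two consecutive tail sums, hence the next entry of d
or of a after a split. -/
theorem lt_unionSeq_iff (ha : IsPartition s a) (hd : IsPartition m d) {p : ℕ} (hp : 1 ≤ p)
    (hpw : p ≤ m + s) (v : ℤ) :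
    v < unionSeq s m a d p ↔ p ≤ #{i ∈ Icc 1 s | v < a i} + #{j ∈ Icc 1 m | v < d j} := by
  obtain ⟨x, r, hxr, h⟩ := exists_isSplit ha hd (by omega : p - 1 ≤ m + s)
  obtain rfl : p = x + r + 1 := by omega
  have e1 := h.tailSum_unionSeq ha hd
  rw [tailSum_of_lt _ (by omega)] at e1
  have hA := card_filter_Icc_le s fun i => v < a i
  have hD := card_filter_Icc_le m fun i => v < d i
  have hAle := @IsPartition.le_card_lt_iff _ _ ha
  have hDle := @IsPartition.le_card_lt_iff _ _ hd
  have hh := h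
  obtain ⟨hx, hr, h1, h2⟩ := hh
  rcases h.succ ha hd (by omega) with ⟨hlt, hc, h'⟩ | ⟨hlt, hc, h'⟩
  · have e2 := h'.tailSum_unionSeq ha hd
    rw [show x + 1 + r = x + r + 1 by omega] at e2
    rw [tailSum_of_lt d hlt] at e1
    have e3 : unionSeq s m a d (x + r + 1) = d (x + 1) := by linarith
    rw [e3]
    have i1 := hDle (v := v) (by omega : 1 ≤ x + 1) (by omega)
    constructor
    · intro hv
      have i2 := i1.2 hv
      rcases Nat.eq_zero_or_pos r with h0 | h0
      · omega
      · have i3 := (hAle (v := v) h0 hr).2 (by rcases h1 with h1 | h1 | h1 <;> omega)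
        omega
    · intro hv
      by_contra hn
      have i2 := mt i1.1 hn
      have i3 := (hAle (v := v) (by omega : 1 ≤ r + 1) (by omega)).1 (by omega)
      rcases hc with hc | hc <;> omega
  · have e2 := h'.tailSum_unionSeq ha hd
    rw [show x + (r + 1) = x + r + 1 by omega] at e2
    rw [tailSum_of_lt a hlt] at e1
    have e3 : unionSeq s m a d (x + r + 1) = a (r + 1) := by linarith
    rw [e3]
    have i1 := hAle (v := v) (by omega : 1 ≤ r + 1) (by omega)
    constructor
    · intro hv
      have i2 := i1.2 hv
      rcases Nat.eq_zero_or_pos x with h0 | h0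
      · omega
      · have i3 := (hDle (v := v) h0 hx).2 (by rcases h2 with h2 | h2 | h2 <;> omega)
        omega
    · intro hv
      by_contra hn
      have i2 := mt i1.1 hn
      have i3 := (hDle (v := v) (by omega : 1 ≤ x + 1) (by omega)).1 (by omega)
      rcases hc with hc | hc <;> omega

end Union

/-! ### The stages of the construction -/

/-- The partitions `a`, `d`, `b`, `c` together with candidates for the sets `S` and `Δ`. -/
structure Config where
  m : ℕ
  s : ℕ
  n : ℕ
  k : ℕ
  a : ℕ → ℤ
  d : ℕ → ℤ
  b : ℕ → ℤ
  c : ℕ → ℤ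
  S : Finset ℕ
  Δ : Finset ℕ
  size : m + s = n + k
  ha : IsPartition s a
  hd : IsPartition m d
  hb : IsPartition k b
  hc : IsPartition n c
  hS : S ⊆ Icc 1 n
  hΔ : Δ ⊆ Icc 1 m
  hcd : ∀ i ∈ Icc 1 n, ∀ j ∈ Icc 1 m, c i ≠ d j

namespace Config

/-- The configuration in which the two pairs of partitions are exchanged. -/
def swap (X : Config) : Config where
  m := X.n
  s := X.k
  n := X.m
  k := X.s
  a := X.b
  d := X.c
  b := X.a
  c := X.d
  S := X.Δ
  Δ := X.S
  size := X.size.symm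
  ha := X.hb
  hd := X.hc
  hb := X.ha
  hc := X.hd
  hS := X.hΔ
  hΔ := X.hS
  hcd := fun i hi j hj => (X.hcd j hj i hi).symm

variable (X : Config)

@[simp] theorem swap_m : X.swap.m = X.n := rfl
@[simp] theorem swap_s : X.swap.s = X.k := rfl
@[simp] theorem swap_n : X.swap.n = X.m := rfl
@[simp] theorem swap_k : X.swap.k = X.s := rfl
@[simp] theorem swap_a : X.swap.a = X.b := rfl
@[simp] theorem swap_d : X.swap.d = X.c := rfl
@[simp] theorem swap_b : X.swap.b = X.a := rfl
@[simp] theorem swap_c : X.swap.c = X.d := rfl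
@[simp] theorem swap_S : X.swap.S = X.Δ := rfl
@[simp] theorem swap_Δ : X.swap.Δ = X.S := rfl

/-- The number of entries of `a` that are at least `d_j`. -/
def rank (j : ℕ) : ℕ := #{i ∈ Icc 1 X.s | X.d j ≤ X.a i}

/-- The number of elements chosen (put into `S` or `Δ`) when `d_1, …, d_p` and `c_1, …, c_r` are
still to be treated. -/
def chosen (p r : ℕ) : ℕ := #{i ∈ X.S | r < i} + #{i ∈ X.Δ | p < i}

/-- The largest position that is not yet occupied by a chosen element, when `d_1, …, d_p` and
`c_1, …, c_r` are still to be treated. -/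
def pos (p r : ℕ) : ℕ := X.m + X.s - X.chosen p r

/-- The sum of the elements chosen when `d_1, …, d_p` and `c_1, …, c_r` are still to be treated. -/
def total (p r : ℕ) : ℤ := ∑ i ∈ X.S with r < i, X.c i + ∑ i ∈ X.Δ with p < i, X.d i

/-- A simplified form of the criterion by which `d_j` is left out of `Δ`. -/
def Skip (p r j : ℕ) : Prop :=
  X.pos p r < p + X.rank j ∨
    (X.pos p r < p + X.s ∧
      X.d j + tailSum X.m X.d p + tailSum X.s X.a (X.pos p r + 1 - p) ≤ X.total p r)

/-- The stages through which the construction of `S` and `Δ` runs, if elements are left out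
according to `Skip`. -/
inductive Run : ℕ → ℕ → Prop
  | init : Run X.m X.n
  | fst {p r : ℕ} : Run (p + 1) r → (r = 0 ∨ X.d (p + 1) < X.c r) →
      (p + 1 ∈ X.Δ ↔ ¬ X.Skip (p + 1) r (p + 1)) → Run p r
  | snd {p r : ℕ} : Run p (r + 1) → (p = 0 ∨ X.c (r + 1) < X.d p) →
      (r + 1 ∈ X.S ↔ ¬ X.swap.Skip (r + 1) p (r + 1)) → Run p r

variable {X}

/-! ### Bookkeeping of positions and sums along a run -/

theorem chosen_swap (p r : ℕ) : X.swap.chosen r p = X.chosen p r := by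
  simp [chosen, add_comm]

theorem pos_swap (p r : ℕ) : X.swap.pos r p = X.pos p r := by
  simp [pos, chosen_swap, X.size]

theorem total_swap (p r : ℕ) : X.swap.total r p = X.total p r := by
  simp [total, add_comm]

theorem Run.swap {p r : ℕ} (h : X.Run p r) : X.swap.Run r p := by
  induction h with
  | init => exact Run.init
  | fst _ h1 h2 ih => exact Run.snd ih h1 h2
  | snd _ h1 h2 ih => exact Run.fst ih h1 h2

theorem rank_le (j : ℕ) : X.rank j ≤ X.s := card_filter_Icc_le _ _

theorem filter_lt_eq_insert {A : Finset ℕ} {p : ℕ} (h : p + 1 ∈ A) :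
    ({i ∈ A | p < i} : Finset ℕ) = insert (p + 1) {i ∈ A | p + 1 < i} := by
  ext i
  simp only [mem_filter, mem_insert]
  constructor
  · rintro ⟨h1, h2⟩
    by_cases hi : i = p + 1
    · exact Or.inl hi
    · exact Or.inr ⟨h1, by omega⟩
  · rintro (rfl | ⟨h1, h2⟩)
    · exact ⟨h, by omega⟩
    · exact ⟨h1, by omega⟩

theorem filter_lt_eq_self {A : Finset ℕ} {p : ℕ} (h : p + 1 ∉ A) :
    ({i ∈ A | p < i} : Finset ℕ) = {i ∈ A | p + 1 < i} := by
  ext i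
  simp only [mem_filter]
  constructor
  · rintro ⟨h1, h2⟩
    refine ⟨h1, ?_⟩
    by_contra hi
    obtain rfl : i = p + 1 := by omega
    exact h h1
  · rintro ⟨h1, h2⟩
    exact ⟨h1, by omega⟩

theorem chosen_of_mem_Δ {p : ℕ} (r : ℕ) (h : p + 1 ∈ X.Δ) :
    X.chosen p r = X.chosen (p + 1) r + 1 := by
  rw [chosen, chosen, filter_lt_eq_insert h, card_insert_of_notMem (by simp)]
  omega

theorem chosen_of_notMem_Δ {p : ℕ} (r : ℕ) (h : p + 1 ∉ X.Δ) :
    X.chosen p r = X.chosen (p + 1) r := by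
  rw [chosen, chosen, filter_lt_eq_self h]

theorem chosen_of_mem_S {r : ℕ} (p : ℕ) (h : r + 1 ∈ X.S) :
    X.chosen p r = X.chosen p (r + 1) + 1 := by
  simpa [chosen_swap] using X.swap.chosen_of_mem_Δ p h

theorem chosen_of_notMem_S {r : ℕ} (p : ℕ) (h : r + 1 ∉ X.S) :
    X.chosen p r = X.chosen p (r + 1) := by
  simpa [chosen_swap] using X.swap.chosen_of_notMem_Δ p h

theorem pos_of_mem_Δ {p : ℕ} (r : ℕ) (h : p + 1 ∈ X.Δ) :
    X.pos p r = X.pos (p + 1) r - 1 := by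
  rw [pos, pos, chosen_of_mem_Δ r h]
  omega

theorem pos_of_notMem_Δ {p : ℕ} (r : ℕ) (h : p + 1 ∉ X.Δ) : X.pos p r = X.pos (p + 1) r := by
  rw [pos, pos, chosen_of_notMem_Δ r h]

theorem pos_of_mem_S {r : ℕ} (p : ℕ) (h : r + 1 ∈ X.S) :
    X.pos p r = X.pos p (r + 1) - 1 := by
  rw [pos, pos, chosen_of_mem_S p h]
  omega

theorem pos_of_notMem_S {r : ℕ} (p : ℕ) (h : r + 1 ∉ X.S) : X.pos p r = X.pos p (r + 1) := by
  rw [pos, pos, chosen_of_notMem_S p h]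

theorem total_of_mem_Δ {p : ℕ} (r : ℕ) (h : p + 1 ∈ X.Δ) :
    X.total p r = X.total (p + 1) r + X.d (p + 1) := by
  rw [total, total, filter_lt_eq_insert h, sum_insert (by simp)]
  ring

theorem total_of_notMem_Δ {p : ℕ} (r : ℕ) (h : p + 1 ∉ X.Δ) :
    X.total p r = X.total (p + 1) r := by
  rw [total, total, filter_lt_eq_self h]

theorem total_of_mem_S {r : ℕ} (p : ℕ) (h : r + 1 ∈ X.S) :
    X.total p r = X.total p (r + 1) + X.c (r + 1) := by
  simpa [total_swap] using X.swap.total_of_mem_Δ p h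

theorem total_of_notMem_S {r : ℕ} (p : ℕ) (h : r + 1 ∉ X.S) :
    X.total p r = X.total p (r + 1) := by
  simpa [total_swap] using X.swap.total_of_notMem_Δ p h

theorem chosen_init : X.chosen X.m X.n = 0 := by
  have h1 : ({i ∈ X.S | X.n < i} : Finset ℕ) = ∅ := by
    refine filter_eq_empty_iff.2 fun i hi => ?_
    have := mem_Icc.1 (X.hS hi)
    omega
  have h2 : ({i ∈ X.Δ | X.m < i} : Finset ℕ) = ∅ := by
    refine filter_eq_empty_iff.2 fun i hi => ?_
    have := mem_Icc.1 (X.hΔ hi)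
    omega
  rw [chosen, h1, h2]
  rfl

theorem pos_init : X.pos X.m X.n = X.m + X.s := by
  rw [pos, chosen_init, Nat.sub_zero]

theorem total_init : X.total X.m X.n = 0 := by
  have h := chosen_init (X := X)
  rw [chosen, Nat.add_eq_zero_iff, card_eq_zero, card_eq_zero] at h
  rw [total, h.1, h.2, sum_empty, sum_empty, add_zero]

namespace Run

variable {p r : ℕ}

theorem le_fst (h : X.Run p r) : p ≤ X.m := by
  induction h with
  | init => exact le_rfl
  | fst _ _ _ ih => omega
  | snd _ _ _ ih => exact ih

theorem le_snd (h : X.Run p r) : r ≤ X.n := h.swap.le_fst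

theorem fst_lt_snd (h : X.Run p r) {i l : ℕ} (hi : p < i) (him : i ≤ X.m) (hl : 1 ≤ l)
    (hlr : l ≤ r) : X.d i < X.c l := by
  induction h with
  | init => omega
  | @fst p r h0 h1 _ ih =>
    by_cases hp : i = p + 1
    · subst hp
      have h2 : X.d (p + 1) < X.c r := by
        rcases h1 with h1 | h1
        · omega
        · exact h1
      exact h2.trans_le (X.hc.le hl hlr h0.le_snd)
    · exact ih (by omega) hlr
  | snd _ _ _ ih => exact ih hi (by omega)

theorem snd_lt_fst (h : X.Run p r) {i l : ℕ} (hl : r < l) (hln : l ≤ X.n) (hi : 1 ≤ i)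
    (hip : i ≤ p) : X.c l < X.d i := h.swap.fst_lt_snd hl hln hi hip

theorem unique_fst {p' r' : ℕ} (h : X.Run p r) (h' : X.Run p' r') (he : p + r = p' + r') :
    p = p' := by
  rcases lt_trichotomy p p' with hlt | heq | hlt
  · have h1 := h.fst_lt_snd (i := p') (l := r) hlt h'.le_fst (by omega) le_rfl
    have h2 := h'.snd_lt_fst (i := p') (l := r) (by omega) h.le_snd (by omega) le_rfl
    omega
  · exact heq
  · have h1 := h'.fst_lt_snd (i := p) (l := r') hlt h.le_fst (by omega) le_rfl
    have h2 := h.snd_lt_fst (i := p) (l := r') (by omega) h'.le_snd (by omega) le_rfl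
    omega

theorem le_pos_of_not_skip (h : ¬ X.Skip p r p) : p + X.rank p ≤ X.pos p r := by
  rw [Skip, not_or] at h
  omega

/-- The level P - p can grow only when an element of d is left out, and both alternatives of `Skip`
then leave room below s. -/
theorem pos_le (h : X.Run p r) : X.pos p r ≤ p + X.s := by
  induction h with
  | init => rw [pos_init]
  | @fst p r h0 h1 h2 ih =>
    by_cases hm : p + 1 ∈ X.Δ
    · rw [pos_of_mem_Δ r hm]
      omega
    · rw [pos_of_notMem_Δ r hm]
      have hs : X.Skip (p + 1) r (p + 1) := not_not.1 (mt h2.2 hm)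
      have := X.rank_le (p + 1)
      rcases hs with hs | hs <;> omega
  | @snd p r h0 h1 h2 ih =>
    by_cases hm : r + 1 ∈ X.S
    · rw [pos_of_mem_S p hm]
      omega
    · rwa [pos_of_notMem_S p hm]

/-- The subtraction in `pos` is never truncated: an element that is not skipped has at least one
free position to go to. -/
theorem pos_add_chosen (h : X.Run p r) : X.pos p r + X.chosen p r = X.m + X.s := by
  induction h with
  | init => rw [pos_init, chosen_init, add_zero]
  | @fst p r h0 h1 h2 ih =>
    by_cases hm : p + 1 ∈ X.Δ
    · rw [pos_of_mem_Δ r hm, chosen_of_mem_Δ r hm]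
      have := le_pos_of_not_skip (h2.1 hm)
      omega
    · rw [pos_of_notMem_Δ r hm, chosen_of_notMem_Δ r hm, ih]
  | @snd p r h0 h1 h2 ih =>
    by_cases hm : r + 1 ∈ X.S
    · rw [pos_of_mem_S p hm, chosen_of_mem_S p hm]
      have := le_pos_of_not_skip (X := X.swap) (h2.1 hm)
      rw [pos_swap] at this
      omega
    · rw [pos_of_notMem_S p hm, chosen_of_notMem_S p hm, ih]

theorem pos_le_size (h : X.Run p r) : X.pos p r ≤ X.m + X.s := by
  have := h.pos_add_chosen
  omega

end Run

theorem Skip.mono {p r i j : ℕ} (h : X.Skip p r i) (hi : 1 ≤ i) (hij : i ≤ j) (hj : j ≤ X.m) :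
    X.Skip p r j := by
  have hd := X.hd.le hi hij hj
  rcases h with h | h
  · left
    have : X.rank i ≤ X.rank j := by
      refine card_le_card fun x hx => ?_
      rw [mem_filter] at hx ⊢
      exact ⟨hx.1, hd.trans hx.2⟩
    omega
  · right
    exact ⟨h.1, by linarith [h.2]⟩

/-- Once an element of `d` bigger than all of the chosen elements of `c` has been put into `Δ`, all
elements of `d` are, until the next element of `c` is chosen. -/
theorem Run.not_skip {p r : ℕ} (h : X.Run p r)
    (hex : ∃ i ∈ X.Δ, p < i ∧ ∀ l ∈ X.S, r < l → X.c l < X.d i)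
    {i : ℕ} (hi : 1 ≤ i) (hip : i ≤ p) : ¬ X.Skip p r i := by
  induction h generalizing i with
  | init =>
    obtain ⟨i, hi, hlt, -⟩ := hex
    have := mem_Icc.1 (X.hΔ hi)
    omega
  | @fst p r h0 h1 h2 ih =>
    by_cases hm : p + 1 ∈ X.Δ
    · have hns := h2.1 hm
      intro hs
      have hle := Run.le_pos_of_not_skip hns
      have hpm := h0.le_fst
      -- `Skip` for d_i is carried back to the stage (p + 1, r): there P and p are both larger by
      -- one, so P + 1 - p is unchanged, and d_{p+1} cancels from the two sides of the sum
      -- inequality.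
      apply mt (fun h => Skip.mono h hi (by omega : i ≤ p + 1) hpm) hns
      have hpos : X.pos (p + 1) r = X.pos p r + 1 := by
        rw [pos_of_mem_Δ r hm]
        omega
      rcases hs with hs | hs
      · left
        omega
      · right
        refine ⟨by omega, ?_⟩
        have h3 := hs.2
        rw [total_of_mem_Δ r hm, tailSum_of_lt X.d (by omega : p < X.m)] at h3
        rw [hpos, show X.pos p r + 1 + 1 - (p + 1) = X.pos p r + 1 - p by omega]
        linarith
    · exfalso
      refine ih ?_ (by omega) le_rfl (not_not.1 (mt h2.2 hm))
      obtain ⟨i, hi, hlt, hi'⟩ := hex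
      refine ⟨i, hi, ?_, hi'⟩
      by_contra hlt'
      obtain rfl : i = p + 1 := by omega
      exact hm hi
  | @snd p r h0 h1 h2 ih =>
    obtain ⟨j, hj, hlt, hj'⟩ := hex
    have hjm := mem_Icc.1 (X.hΔ hj)
    by_cases hm : r + 1 ∈ X.S
    -- A newly chosen c_{r+1} exceeds the treated d_j, against the assumption on d_j.
    · have h3 := h0.fst_lt_snd hlt hjm.2 (by omega : 1 ≤ r + 1) le_rfl
      have h4 := hj' _ hm (by omega)
      omega
    · have h3 := ih ⟨j, hj, hlt, fun l hl hrl => hj' l hl (by omega)⟩ hi hip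
      rwa [Skip, ← pos_of_notMem_S p hm, ← total_of_notMem_S p hm] at h3

end Config

/-! ### Tests (a) and (b) in terms of free positions -/

namespace Config

variable (X : Config)

theorem card_lt_add_card_gt {l : ℕ} (hl : l ∈ Icc 1 X.n) :
    #{i ∈ Icc 1 X.m | X.d i < X.c l} + #{i ∈ Icc 1 X.m | X.c l < X.d i} = X.m := by
  have h := card_filter_add_card_filter_not (s := Icc 1 X.m) fun i => X.d i < X.c l
  have h' : ({i ∈ Icc 1 X.m | X.c l < X.d i} : Finset ℕ)
      = {i ∈ Icc 1 X.m | ¬ X.d i < X.c l} := by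
    refine filter_congr fun i hi => ?_
    have := X.hcd l hl i hi
    omega
  rw [h', h, Nat.card_Icc, Nat.add_sub_cancel]

theorem filter_Δ_subset (p : ℕ) : ({i ∈ X.Δ | p < i} : Finset ℕ) ⊆ Ioc p X.m := by
  intro i hi
  rw [mem_filter] at hi
  exact mem_Ioc.2 ⟨hi.2, (mem_Icc.1 (X.hΔ hi.1)).2⟩

theorem filter_notMem_eq_sdiff (p : ℕ) :
    ({i ∈ Icc (p + 1) X.m | i ∉ ({i ∈ X.Δ | p < i} : Finset ℕ)} : Finset ℕ)
      = Ioc p X.m \ {i ∈ X.Δ | p < i} := by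
  ext i
  simp only [mem_filter, mem_sdiff, mem_Ioc, mem_Icc, Order.add_one_le_iff]

theorem card_notMem_add (p : ℕ) :
    #{i ∈ Icc (p + 1) X.m | i ∉ ({i ∈ X.Δ | p < i} : Finset ℕ)} + #{i ∈ X.Δ | p < i}
      = X.m - p := by
  rw [filter_notMem_eq_sdiff, card_sdiff_add_card_eq_card (X.filter_Δ_subset p), Nat.card_Ioc]

theorem sum_notMem_add (p : ℕ) :
    ∑ i ∈ Icc (p + 1) X.m with i ∉ ({i ∈ X.Δ | p < i} : Finset ℕ), X.d i
      + ∑ i ∈ X.Δ with p < i, X.d i = tailSum X.m X.d p := by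
  rw [filter_notMem_eq_sdiff, sum_sdiff (X.filter_Δ_subset p), tailSum]

variable {X}

namespace Run

variable {p r : ℕ}

theorem filter_S_lt (h : X.Run p r) (hp : 1 ≤ p) :
    ({i ∈ ({i ∈ X.S | r < i} : Finset ℕ) | X.c i < X.d p} : Finset ℕ) = {i ∈ X.S | r < i} := by
  refine filter_true_of_mem fun i hi => ?_
  rw [mem_filter] at hi
  exact h.snd_lt_fst hi.2 (mem_Icc.1 (X.hS hi.1)).2 hp le_rfl

theorem qIndex_eq (h : X.Run p r) (hp : 1 ≤ p) :
    qIndex X.s X.m X.d X.c {i ∈ X.S | r < i} {i ∈ X.Δ | p < i} p = (X.pos p r : ℤ) - p + 1 := by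
  have h1 := X.card_notMem_add p
  have h2 := h.pos_add_chosen
  have h3 := h.le_fst
  rw [chosen] at h2
  rw [qIndex, h.filter_S_lt hp]
  omega

theorem testB_iff (h : X.Run p r) (hp : 1 ≤ p) :
    TestB X.s X.m X.a X.d X.c {i ∈ X.S | r < i} {i ∈ X.Δ | p < i} p ↔
      p ≤ X.pos p r + 1 ∧
        X.d p + tailSum X.m X.d p + tailSum X.s X.a (X.pos p r + 1 - p) ≤ X.total p r := by
  rw [TestB, h.qIndex_eq hp, h.filter_S_lt hp, sum_Icc_succ_eq_tailSum, total,
    ← X.sum_notMem_add p]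
  have h1 : 0 ≤ (X.pos p r : ℤ) - p + 1 ↔ p ≤ X.pos p r + 1 := by omega
  have h2 : ((X.pos p r : ℤ) - p + 1).toNat = X.pos p r + 1 - p := by omega
  rw [h1, h2]
  refine and_congr_right fun _ => ?_
  constructor <;> intro h <;> linarith

/-- The entries of e counted in the test occupy an interval that starts at the position p + rank of
d_p; the number of a_i > c_l cancels against the excess. The interval is nonempty, so nonnegativity
of the excess comes for free. What remains, besides the comparison of P with that position, is the
number of chosen d_i above c_l. -/
theorem testA_iff (h : X.Run p r) (hp : 1 ≤ p) :
    TestA X.s X.m X.a X.d X.c {i ∈ X.S | r < i} {i ∈ X.Δ | p < i} p ↔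
      ∃ l ∈ X.S, r < l ∧ (∀ i ∈ X.S, r < i → l ≤ i) ∧
        X.pos p r + 1 + #{i ∈ X.Δ | p < i ∧ X.c l < X.d i} ≤ p + X.rank p := by
  have hlt : ∀ i ∈ X.S, r < i → X.c i < X.d p := fun i hi hri =>
    h.snd_lt_fst hri (mem_Icc.1 (X.hS hi)).2 hp le_rfl
  have key : ∀ l ∈ X.S, r < l → (∀ i ∈ X.S, r < i → l ≤ i) →
      ((0 ≤ excess X.s X.m X.a X.d X.c {i ∈ X.S | r < i} {i ∈ X.Δ | p < i} l ∧
        (#{x ∈ Icc (posSnd X.s X.a X.d p) (X.m + X.s) |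
            X.c l < unionSeq X.s X.m X.a X.d x} : ℤ)
          ≤ excess X.s X.m X.a X.d X.c {i ∈ X.S | r < i} {i ∈ X.Δ | p < i} l + 1) ↔
        X.pos p r + 1 + #{i ∈ X.Δ | p < i ∧ X.c l < X.d i} ≤ p + X.rank p) := by
    intro l hl hrl hmin
    have hln := X.hS hl
    have hcl := hlt l hl hrl
    have e1 : #{i ∈ ({i ∈ X.S | r < i} : Finset ℕ) | l < i} + 1 = #{i ∈ X.S | r < i} := by
      have : ({i ∈ X.S | r < i} : Finset ℕ)
          = insert l {i ∈ ({i ∈ X.S | r < i} : Finset ℕ) | l < i} := by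
        ext i
        simp only [mem_filter, mem_insert]
        constructor
        · rintro ⟨hi, hri⟩
          have := hmin i hi hri
          by_cases hil : i = l
          · exact Or.inl hil
          · exact Or.inr ⟨⟨hi, hri⟩, by omega⟩
        · rintro (rfl | hi)
          · exact ⟨hl, hrl⟩
          · exact hi.1
      conv_rhs => rw [this]
      rw [card_insert_of_notMem (by simp)]
    have e2 : #{i ∈ Icc 1 X.m | i ∉ ({i ∈ X.Δ | p < i} : Finset ℕ) ∧ X.d i < X.c l}
        + #{i ∈ ({i ∈ X.Δ | p < i} : Finset ℕ) | X.d i < X.c l}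
        = #{i ∈ Icc 1 X.m | X.d i < X.c l} := by
      rw [← card_union_of_disjoint]
      · congr 1
        ext i
        have := @X.hΔ i
        simp only [mem_filter, mem_union]
        tauto
      · rw [disjoint_left]
        intro i hi hi'
        simp only [mem_filter] at hi hi'
        tauto
    have e3 : #{i ∈ ({i ∈ X.Δ | p < i} : Finset ℕ) | X.d i < X.c l}
        + #{i ∈ X.Δ | p < i ∧ X.c l < X.d i} = #{i ∈ X.Δ | p < i} := by
      rw [← card_filter_add_card_filter_not (s := {i ∈ X.Δ | p < i}) fun i => X.d i < X.c l,
        ← filter_filter]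
      congr 2
      refine filter_congr fun i hi => ?_
      have := X.hcd l hln i (X.hΔ (mem_filter.1 hi).1)
      omega
    have e4 := X.card_lt_add_card_gt hln
    have e5 := h.pos_add_chosen
    rw [chosen] at e5
    have e6 : X.rank p ≤ #{i ∈ Icc 1 X.s | X.c l < X.a i} := by
      refine card_le_card fun i hi => ?_
      rw [mem_filter] at hi ⊢
      exact ⟨hi.1, hcl.trans_le hi.2⟩
    have e7 := (X.hd.le_card_lt_iff hp h.le_fst).2 hcl
    have e8 := card_filter_Icc_le X.s fun i => X.c l < X.a i
    have e9 : posSnd X.s X.a X.d p = p + X.rank p := rfl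
    have e10 : ({x ∈ Icc (posSnd X.s X.a X.d p) (X.m + X.s) |
        X.c l < unionSeq X.s X.m X.a X.d x} : Finset ℕ)
        = Icc (p + X.rank p)
          (#{i ∈ Icc 1 X.s | X.c l < X.a i} + #{i ∈ Icc 1 X.m | X.c l < X.d i}) := by
      ext x
      rw [mem_filter, e9, mem_Icc, mem_Icc]
      constructor
      · rintro ⟨⟨h1, h2⟩, h3⟩
        exact ⟨h1, (lt_unionSeq_iff X.ha X.hd (by omega) h2 _).1 h3⟩
      · rintro ⟨h1, h2⟩
        exact ⟨⟨h1, by omega⟩, (lt_unionSeq_iff X.ha X.hd (by omega) (by omega) _).2 h2⟩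
    rw [e10, Nat.card_Icc, excess]
    omega
  rw [TestA]
  constructor
  · rintro ⟨l, hl, ⟨-, hmin⟩, hN⟩
    rw [mem_filter] at hl
    have hmin' : ∀ i ∈ X.S, r < i → l ≤ i := fun i hi hri =>
      hmin i (mem_filter.2 ⟨hi, hri⟩) (hlt i hi hri)
    exact ⟨l, hl.1, hl.2, hmin', (key l hl.1 hl.2 hmin').1 hN⟩
  · rintro ⟨l, hl, hrl, hmin, hN⟩
    exact ⟨l, mem_filter.2 ⟨hl, hrl⟩, ⟨hlt l hl hrl, fun i hi _ =>
      hmin i (mem_filter.1 hi).1 (mem_filter.1 hi).2⟩, (key l hl hrl hmin).2 hN⟩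

/-- The correction term in `testA_iff` vanishes whenever `Skip` holds, by `Run.not_skip`. The
truncated P + 1 - p in `Skip` is harmless: if p > P + 1, the first alternative holds anyway. -/
theorem leftOut_iff_skip (h : X.Run p r) (hp : 1 ≤ p) :
    LeftOut X.s X.m X.a X.d X.c {i ∈ X.S | r < i} {i ∈ X.Δ | p < i} p ↔ X.Skip p r p := by
  have hrank := X.rank_le p
  rw [LeftOut, h.testA_iff hp, h.testB_iff hp, h.qIndex_eq hp]
  constructor
  · rintro ⟨hq, ⟨l, -, -, -, hA⟩ | hB⟩
    · left
      omega
    · right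
      exact ⟨by omega, hB.2⟩
  · intro hs
    by_cases hlt : X.pos p r < p + X.rank p
    · refine ⟨by omega, Or.inl ?_⟩
      have h1 := X.card_notMem_add p
      have h2 := h.pos_add_chosen
      have h3 := h.le_fst
      rw [chosen] at h2
      -- P < p + s means that more than m - p elements have been chosen, and at most m - p of them
      -- belong to d.
      have hne : ({i ∈ X.S | r < i} : Finset ℕ).Nonempty := by
        rw [← card_pos]
        omega
      refine ⟨_, (mem_filter.1 (min'_mem _ hne)).1, (mem_filter.1 (min'_mem _ hne)).2,
        fun i hi hri => min'_le _ _ (mem_filter.2 ⟨hi, hri⟩), ?_⟩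
      rw [filter_eq_empty_iff.2, card_empty]
      · omega
      · rintro i hi ⟨hpi, hci⟩
        refine h.not_skip ⟨i, hi, hpi, fun l hl hrl => ?_⟩ hp le_rfl hs
        refine lt_of_le_of_lt (X.hc.le ?_ (min'_le _ _ (mem_filter.2 ⟨hl, hrl⟩)) ?_) hci
        · exact (mem_Icc.1 (X.hS (mem_filter.1 (min'_mem _ hne)).1)).1
        · exact (mem_Icc.1 (X.hS hl)).2
    · rcases hs with hs | hs
      · exact absurd hs hlt
      · exact ⟨by omega, Or.inr ⟨by omega, hs.2⟩⟩

end Run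

end Config

/-! ### The sets produced by the construction -/

section Construction

variable {m s n k : ℕ} {a d b c : ℕ → ℤ}

theorem step_cases {σ : Stage} (h : 0 < σ.p + σ.r) :
    (0 < σ.p ∧ (σ.r = 0 ∨ d σ.p < c σ.r) ∧ (step m s n k a d b c σ).p = σ.p - 1 ∧
      (step m s n k a d b c σ).r = σ.r ∧ (step m s n k a d b c σ).S = σ.S ∧
      (step m s n k a d b c σ).Δ
        = if LeftOut s m a d c σ.S σ.Δ σ.p then σ.Δ else insert σ.p σ.Δ) ∨
    (0 < σ.r ∧ (σ.p = 0 ∨ ¬ d σ.p < c σ.r) ∧ (step m s n k a d b c σ).p = σ.p ∧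
      (step m s n k a d b c σ).r = σ.r - 1 ∧ (step m s n k a d b c σ).Δ = σ.Δ ∧
      (step m s n k a d b c σ).S
        = if LeftOut k n b c d σ.Δ σ.S σ.r then σ.S else insert σ.r σ.S) := by
  by_cases h1 : 0 < σ.p ∧ (σ.r = 0 ∨ d σ.p < c σ.r)
  · left
    rw [step, if_pos h1]
    exact ⟨h1.1, h1.2, rfl, rfl, rfl, rfl⟩
  · right
    have h2 : 0 < σ.r := by
      by_contra h2
      exact h1 ⟨by omega, Or.inl (by omega)⟩
    rw [step, if_neg h1, if_pos h2]
    refine ⟨h2, ?_, rfl, rfl, rfl, rfl⟩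
    by_contra h3
    rw [not_or, not_not] at h3
    exact h1 ⟨by omega, Or.inr h3.2⟩

theorem filter_insert_lt {A : Finset ℕ} {p q : ℕ} (h : p ≤ q) :
    ({i ∈ insert p A | q < i} : Finset ℕ) = {i ∈ A | q < i} := by
  rw [filter_insert, if_neg (by omega)]

/-- Later steps do not change the elements of `S` and `Δ` chosen at an earlier stage. -/
theorem iterate_step_filter (σ : Stage) (N : ℕ) (hN : N ≤ σ.p + σ.r)
    (hS : ∀ i ∈ σ.S, σ.r < i) (hΔ : ∀ i ∈ σ.Δ, σ.p < i) :
    let τ := (step m s n k a d b c)^[N] σ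
    τ.p ≤ σ.p ∧ τ.r ≤ σ.r ∧ τ.p + τ.r + N = σ.p + σ.r ∧
      ({i ∈ τ.S | σ.r < i} : Finset ℕ) = σ.S ∧ ({i ∈ τ.Δ | σ.p < i} : Finset ℕ) = σ.Δ ∧
      (∀ i ∈ τ.S, i ∈ σ.S ∨ (τ.r < i ∧ i ≤ σ.r)) ∧
      (∀ i ∈ τ.Δ, i ∈ σ.Δ ∨ (τ.p < i ∧ i ≤ σ.p)) := by
  induction N with
  | zero =>
    exact ⟨le_rfl, le_rfl, rfl, filter_true_of_mem hS, filter_true_of_mem hΔ,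
      fun i hi => Or.inl hi, fun i hi => Or.inl hi⟩
  | succ N ih =>
    obtain ⟨h1, h2, h3, h4, h5, h6, h7⟩ := ih (by omega)
    rw [Function.iterate_succ_apply']
    set τ := (step m s n k a d b c)^[N] σ
    rcases step_cases (m := m) (s := s) (n := n) (k := k) (a := a) (d := d) (b := b) (c := c)
      (σ := τ) (by omega) with ⟨hp, -, e1, e2, e3, e4⟩ | ⟨hr, -, e1, e2, e3, e4⟩
    · simp only [e1, e2, e3]
      refine ⟨by omega, h2, by omega, h4, ?_, h6, ?_⟩
      · rw [e4]
        split_ifs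
        · exact h5
        · rw [filter_insert_lt h1, h5]
      · intro i hi
        have : i = τ.p ∨ i ∈ τ.Δ := by
          rw [e4] at hi
          split_ifs at hi
          · exact Or.inr hi
          · exact mem_insert.1 hi
        rcases this with rfl | hi'
        · right; omega
        · rcases h7 i hi' with h | h
          · exact Or.inl h
          · right; omega
    · simp only [e1, e2, e3]
      refine ⟨h1, by omega, by omega, ?_, h5, ?_, h7⟩
      · rw [e4]
        split_ifs
        · exact h4
        · rw [filter_insert_lt h2, h4]
      · intro i hi
        have : i = τ.r ∨ i ∈ τ.S := by
          rw [e4] at hi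
          split_ifs at hi
          · exact Or.inr hi
          · exact mem_insert.1 hi
        rcases this with rfl | hi'
        · right; omega
        · rcases h6 i hi' with h | h
          · exact Or.inl h
          · right; omega

theorem setS_subset : setS m s n k a d b c ⊆ Icc 1 n := by
  obtain ⟨-, -, -, -, -, h, -⟩ := iterate_step_filter (m := m) (s := s) (n := n) (k := k)
    (a := a) (d := d) (b := b) (c := c) ⟨m, n, ∅, ∅⟩ (m + n) le_rfl (by simp) (by simp)
  intro i hi
  rcases h i hi with h | h
  · simp at h
  · exact mem_Icc.2 ⟨by omega, h.2⟩

theorem setΔ_subset : setΔ m s n k a d b c ⊆ Icc 1 m := by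
  obtain ⟨-, -, -, -, -, -, h⟩ := iterate_step_filter (m := m) (s := s) (n := n) (k := k)
    (a := a) (d := d) (b := b) (c := c) ⟨m, n, ∅, ∅⟩ (m + n) le_rfl (by simp) (by simp)
  intro i hi
  rcases h i hi with h | h
  · simp at h
  · exact mem_Icc.2 ⟨by omega, h.2⟩

/-- The configuration formed by the sets `S` and `Δ` that the construction produces. -/
def configOf (hsize : m + s = n + k) (ha : IsPartition s a) (hd : IsPartition m d)
    (hb : IsPartition k b) (hc : IsPartition n c)
    (hcd : ∀ i ∈ Icc 1 n, ∀ j ∈ Icc 1 m, c i ≠ d j) : Config where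
  m := m
  s := s
  n := n
  k := k
  a := a
  d := d
  b := b
  c := c
  S := setS m s n k a d b c
  Δ := setΔ m s n k a d b c
  size := hsize
  ha := ha
  hd := hd
  hb := hb
  hc := hc
  hS := setS_subset
  hΔ := setΔ_subset
  hcd := hcd

/-- The current sets at each stage are the final sets restricted to the treated indices, so every
decision of the construction is a decision by `Skip` for the final sets. -/
theorem run_configOf (hsize : m + s = n + k) (ha : IsPartition s a) (hd : IsPartition m d)
    (hb : IsPartition k b) (hc : IsPartition n c)
    (hcd : ∀ i ∈ Icc 1 n, ∀ j ∈ Icc 1 m, c i ≠ d j) :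
    (configOf hsize ha hd hb hc hcd).Run 0 0 := by
  set X := configOf hsize ha hd hb hc hcd with hX
  set f := step m s n k a d b c with hf
  set σ₀ : Stage := ⟨m, n, ∅, ∅⟩ with hσ₀
  have hdata : ∀ t ≤ m + n, (f^[t] σ₀).p + (f^[t] σ₀).r + t = m + n ∧
      ({i ∈ X.S | (f^[t] σ₀).r < i} : Finset ℕ) = (f^[t] σ₀).S ∧
      ({i ∈ X.Δ | (f^[t] σ₀).p < i} : Finset ℕ) = (f^[t] σ₀).Δ ∧
      (∀ i ∈ (f^[t] σ₀).S, (f^[t] σ₀).r < i) ∧ (∀ i ∈ (f^[t] σ₀).Δ, (f^[t] σ₀).p < i) := by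
    intro t ht
    obtain ⟨-, -, h3, -, -, h6, h7⟩ := iterate_step_filter (m := m) (s := s) (n := n) (k := k)
      (a := a) (d := d) (b := b) (c := c) σ₀ t ht (by simp [hσ₀]) (by simp [hσ₀])
    have h6' : ∀ i ∈ (f^[t] σ₀).S, (f^[t] σ₀).r < i := fun i hi => by
      rcases h6 i hi with h | h
      · simp [hσ₀] at h
      · exact h.1
    have h7' : ∀ i ∈ (f^[t] σ₀).Δ, (f^[t] σ₀).p < i := fun i hi => by
      rcases h7 i hi with h | h
      · simp [hσ₀] at h
      · exact h.1
    -- A second application, from stage t to the end.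
    obtain ⟨-, -, -, h4, h5, -, -⟩ := iterate_step_filter (m := m) (s := s) (n := n) (k := k)
      (a := a) (d := d) (b := b) (c := c) (f^[t] σ₀) (m + n - t)
      (by
        change (f^[t] σ₀).p + (f^[t] σ₀).r + t = m + n at h3
        omega) h6' h7'
    rw [← hf, ← Function.iterate_add_apply, Nat.sub_add_cancel ht] at h4 h5
    exact ⟨h3, h4, h5, h6', h7'⟩
  have hrun : ∀ t ≤ m + n, X.Run (f^[t] σ₀).p (f^[t] σ₀).r := by
    intro t
    induction t with
    | zero => exact fun _ => Config.Run.init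
    | succ t ih =>
      intro ht
      have hr := ih (by omega)
      obtain ⟨d1, d2, d3, d4, d5⟩ := hdata t (by omega)
      obtain ⟨-, e2, e3, -, -⟩ := hdata (t + 1) ht
      rw [Function.iterate_succ_apply'] at e2 e3 ⊢
      set σ := f^[t] σ₀
      rcases step_cases (m := m) (s := s) (n := n) (k := k) (a := a) (d := d) (b := b) (c := c)
        (σ := σ) (by omega) with ⟨hp, ho, s1, s2, s3, s4⟩ | ⟨hp, ho, s1, s2, s3, s4⟩
      · obtain ⟨p, hp'⟩ : ∃ p, σ.p = p + 1 := ⟨σ.p - 1, by omega⟩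
        have hlo := hr.leftOut_iff_skip (by omega)
        rw [d2, d3, hp'] at hlo
        rw [hp'] at s1 s4 hr ho
        change (f σ).p = p at s1
        rw [s1] at e3 ⊢
        change (f σ).r = _ at s2
        rw [s2]
        refine Config.Run.fst hr ho ?_
        rw [← hlo]
        have hmem : p + 1 ∈ X.Δ ↔ p + 1 ∈ (f σ).Δ := by
          rw [← e3, mem_filter]
          exact ⟨fun h => ⟨h, by omega⟩, fun h => h.1⟩
        rw [hmem]
        change (f σ).Δ = _ at s4
        rw [s4]
        change _ ↔ ¬ LeftOut s m a d c σ.S σ.Δ (p + 1)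
        split_ifs with hL
        · refine ⟨fun h => ?_, fun h => absurd hL h⟩
          have := d5 _ h
          omega
        · exact ⟨fun _ => hL, fun _ => mem_insert_self _ _⟩
      · obtain ⟨p, hp'⟩ : ∃ p, σ.r = p + 1 := ⟨σ.r - 1, by omega⟩
        have hlo := hr.swap.leftOut_iff_skip (by omega)
        rw [Config.swap_S, Config.swap_Δ, d2, d3, hp'] at hlo
        rw [hp'] at s2 s4 hr ho
        change (f σ).r = p at s2
        rw [s2] at e2 ⊢
        change (f σ).p = _ at s1
        rw [s1]
        refine Config.Run.snd hr ?_ ?_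
        · rcases Nat.eq_zero_or_pos σ.p with h0 | h0
          · exact Or.inl h0
          · right
            have hle := hr.le_snd
            have h1 := X.hcd (p + 1) (mem_Icc.2 ⟨by omega, hle⟩) σ.p
              (mem_Icc.2 ⟨h0, hr.le_fst⟩)
            have h2 : ¬ X.d σ.p < X.c (p + 1) := by
              rcases ho with ho | ho
              · omega
              · exact ho
            omega
        rw [← hlo]
        have hmem : p + 1 ∈ X.S ↔ p + 1 ∈ (f σ).S := by
          rw [← e2, mem_filter]
          exact ⟨fun h => ⟨h, by omega⟩, fun h => h.1⟩
        rw [hmem]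
        change (f σ).S = _ at s4
        rw [s4]
        change _ ↔ ¬ LeftOut k n b c d σ.Δ σ.S (p + 1)
        split_ifs with hL
        · refine ⟨fun h => ?_, fun h => absurd hL h⟩
          have := d4 _ h
          omega
        · exact ⟨fun _ => hL, fun _ => mem_insert_self _ _⟩
  have hfin := hrun (m + n) le_rfl
  have h0 := (hdata (m + n) le_rfl).1
  rwa [show (f^[m + n] σ₀).p = 0 by omega, show (f^[m + n] σ₀).r = 0 by omega] at hfin

end Construction

/-! ### The inequalities in terms of stages -/

section Enumeration

variable {S : Finset ℕ}

theorem exists_nth_eq {l : ℕ} (hl : l ∈ S) : ∃ y ∈ Icc 1 #S, Nat.nth (· ∈ S) (y - 1) = l := by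
  have hf : (Set.ofPred (· ∈ S)).Finite := S.finite_toSet
  have hfS : hf.toFinset = S := by ext; simp
  obtain ⟨x, hx, rfl⟩ := Nat.exists_lt_card_finite_nth_eq hf hl
  rw [hfS] at hx
  exact ⟨x + 1, mem_Icc.2 ⟨by omega, by omega⟩, rfl⟩

theorem nth_mem_of_mem_Icc {y : ℕ} (hy : y ∈ Icc 1 #S) : Nat.nth (· ∈ S) (y - 1) ∈ S := by
  have hf : (Set.ofPred (· ∈ S)).Finite := S.finite_toSet
  have hfS : hf.toFinset = S := by ext; simp
  rw [mem_Icc] at hy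
  exact Nat.nth_mem_of_lt_card (p := (· ∈ S)) hf (by rw [hfS]; omega)

theorem sum_sub_eq (c : ℕ → ℤ) {y : ℕ} (hy : y ∈ Icc 1 #S) :
    ∑ i ∈ Icc y #S, sub c S i = ∑ i ∈ S with Nat.nth (· ∈ S) (y - 1) ≤ i, c i := by
  have hf : (Set.ofPred (· ∈ S)).Finite := S.finite_toSet
  have hfS : hf.toFinset = S := by ext; simp
  rw [mem_Icc] at hy
  refine sum_nbij (fun i => Nat.nth (· ∈ S) (i - 1)) ?_ ?_ ?_ fun _ _ => rfl
  · intro i hi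
    rw [mem_Icc] at hi
    exact mem_filter.2 ⟨nth_mem_of_mem_Icc (mem_Icc.2 ⟨by omega, hi.2⟩),
      Nat.nth_le_nth_of_lt_card hf (by omega) (by rw [hfS]; omega)⟩
  · intro i hi j hj hij
    rw [mem_coe, mem_Icc] at hi hj
    have := Nat.nth_injOn hf (by rw [hfS, Set.mem_Iio]; omega)
      (by rw [hfS, Set.mem_Iio]; omega) hij
    omega
  · intro l hl
    rw [mem_coe, mem_filter] at hl
    obtain ⟨x, hx, rfl⟩ := exists_nth_eq hl.1
    rw [mem_Icc] at hx
    have := Nat.le_of_nth_le_nth_of_lt_card hf hl.2 (by rw [hfS]; omega)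
    exact ⟨x, by rw [mem_coe, mem_Icc]; omega, rfl⟩

theorem card_filter_nth_le {y : ℕ} (hy : y ∈ Icc 1 #S) :
    #{i ∈ S | Nat.nth (· ∈ S) (y - 1) ≤ i} = #S + 1 - y := by
  -- Counting is summing the constant sequence 1.
  have h := sum_sub_eq (fun _ => 1) hy
  simp only [sub, sum_const, Nat.card_Icc, mul_one, nsmul_eq_mul] at h
  omega

end Enumeration

namespace Config

variable {X : Config}

/-- The union of `d` and `a`. -/
def union (X : Config) : ℕ → ℤ := unionSeq X.s X.m X.a X.d

/-- The inequality for `c_{r+1}`: after it has been put into `S`, the sum of the chosen elements is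
at least the corresponding tail sum of the union of `d` and `a`. -/
def Bounded (X : Config) : Prop :=
  ∀ p r, X.Run p (r + 1) → X.Run p r → (p = 0 ∨ X.c (r + 1) < X.d p) → r + 1 ∈ X.S →
    X.pos p (r + 1) ≤ p + #{i ∈ Icc 1 X.s | X.c (r + 1) < X.a i} →
      tailSum (X.m + X.s) X.union (X.pos p r) ≤ X.total p r

namespace Run

variable {p r : ℕ}

theorem exists_before_fst (h : X.Run p r) {j : ℕ} (hj : p < j) (hjm : j ≤ X.m) :
    ∃ r', X.Run j r' ∧ X.Run (j - 1) r' ∧ (r' = 0 ∨ X.d j < X.c r') ∧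
      (j ∈ X.Δ ↔ ¬ X.Skip j r' j) := by
  induction h with
  | init => omega
  | @fst p r h0 h1 h2 ih =>
    by_cases hp : j = p + 1
    · subst hp
      exact ⟨r, h0, Run.fst h0 h1 h2, h1, h2⟩
    · exact ih (by omega)
  | snd _ _ _ ih => exact ih hj

theorem exists_before_snd (h : X.Run p r) {l : ℕ} (hl : r < l) (hln : l ≤ X.n) :
    ∃ p', X.Run p' l ∧ X.Run p' (l - 1) ∧ (p' = 0 ∨ X.c l < X.d p') ∧
      (l ∈ X.S ↔ ¬ X.swap.Skip l p' l) := by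
  obtain ⟨p', h1, h2, h3⟩ := h.swap.exists_before_fst hl hln
  exact ⟨p', h1.swap, h2.swap, h3⟩

/-- At the stage treating c^y = c_{r+1} one has z_y = p and z_y + t_y = P, and (z_y, m_y) is a split
of e. Hence the sum of e from P to z_y + m_y, completed by the tails of d and a, is a full tail of
e; moving the d_i with i ∈ Δ to the other side produces `total`. -/
theorem inequality_iff (h : X.Run p (r + 1)) (hlt : p = 0 ∨ X.c (r + 1) < X.d p)
    (hmem : r + 1 ∈ X.S) (hnext : X.Run p r) {y : ℕ} (hy : y ∈ Icc 1 #X.S)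
    (hn : Nat.nth (· ∈ X.S) (y - 1) = r + 1) :
    (tIndex X.s X.m X.d X.c X.S X.Δ y ≤ mIndex X.s X.a X.c X.S y →
      1 ≤ zIndex X.m X.d X.c X.S y + tIndex X.s X.m X.d X.c X.S X.Δ y ∧
      ∑ p ∈ Icc (zIndex X.m X.d X.c X.S y + tIndex X.s X.m X.d X.c X.S X.Δ y).toNat
          (zIndex X.m X.d X.c X.S y + mIndex X.s X.a X.c X.S y), unionSeq X.s X.m X.a X.d p
        ≤ ∑ i ∈ Icc y (#X.S), sub X.c X.S i
          - ∑ i ∈ Icc (zIndex X.m X.d X.c X.S y + 1) X.m with i ∉ X.Δ, X.d i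
          - ∑ i ∈ Icc (mIndex X.s X.a X.c X.S y + 1) X.s, X.a i) ↔
    (X.pos p (r + 1) ≤ p + #{i ∈ Icc 1 X.s | X.c (r + 1) < X.a i} →
      tailSum (X.m + X.s) X.union (X.pos p r) ≤ X.total p r) := by
  have hsub : sub X.c X.S y = X.c (r + 1) := by rw [sub, hn]
  have hpm := h.le_fst
  have hln := X.hS hmem
  have hlow : ∀ i, p < i → i ≤ X.m → X.d i < X.c (r + 1) := fun i hi him =>
    h.fst_lt_snd hi him (by omega) le_rfl
  have hhigh : ∀ i, 1 ≤ i → i ≤ p → X.c (r + 1) < X.d i := fun i hi hip => by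
    rcases hlt with hlt | hlt
    · omega
    · exact hlt.trans_le (X.hd.le hi hip hpm)
  have hz : zIndex X.m X.d X.c X.S y = p := by
    rw [zIndex, hsub]
    have : ({i ∈ Icc 1 X.m | X.c (r + 1) < X.d i} : Finset ℕ) = Icc 1 p := by
      ext i
      simp only [mem_filter, mem_Icc]
      constructor
      · rintro ⟨⟨h1, h2⟩, h3⟩
        refine ⟨h1, ?_⟩
        by_contra hip
        have := hlow i (by omega) h2
        omega
      · rintro ⟨h1, h2⟩
        exact ⟨⟨h1, by omega⟩, hhigh i h1 h2⟩
    rw [this, Nat.card_Icc, Nat.add_sub_cancel]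
  have hm : mIndex X.s X.a X.c X.S y = #{i ∈ Icc 1 X.s | X.c (r + 1) < X.a i} := by
    rw [mIndex, hsub]
  have hsetΔ : ({i ∈ Icc (p + 1) X.m | i ∉ X.Δ} : Finset ℕ)
      = {i ∈ Icc (p + 1) X.m | i ∉ ({i ∈ X.Δ | p < i} : Finset ℕ)} := by
    refine filter_congr fun i hi => ?_
    rw [mem_Icc] at hi
    rw [mem_filter, not_and]
    exact ⟨fun h h' => absurd h' h, fun h h' => h h' (by omega)⟩
  have hpos1 := h.pos_add_chosen
  have hpos2 := hnext.pos_add_chosen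
  rw [chosen_of_mem_S p hmem] at hpos2
  have ht : tIndex X.s X.m X.d X.c X.S X.Δ y = (X.pos p (r + 1) : ℤ) - p := by
    have e1 : ({i ∈ Icc 1 X.m | i ∉ X.Δ ∧ X.d i < X.c (r + 1)} : Finset ℕ)
        = {i ∈ Icc (p + 1) X.m | i ∉ ({i ∈ X.Δ | p < i} : Finset ℕ)} := by
      rw [← hsetΔ]
      ext i
      simp only [mem_filter, mem_Icc]
      constructor
      · rintro ⟨⟨h1, h2⟩, h3, h4⟩
        refine ⟨⟨?_, h2⟩, h3⟩
        by_contra hip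
        have := hhigh i h1 (by omega)
        omega
      · rintro ⟨⟨h1, h2⟩, h3⟩
        exact ⟨⟨by omega, h2⟩, h3, hlow i (by omega) h2⟩
    have e2 := X.card_notMem_add p
    have e3 := card_filter_nth_le hy
    have e4 : ({i ∈ X.S | r + 1 ≤ i} : Finset ℕ) = {i ∈ X.S | r < i} := rfl
    rw [hn, e4, filter_lt_eq_insert hmem, card_insert_of_notMem (by simp)] at e3
    rw [chosen] at hpos1
    rw [mem_Icc] at hy
    rw [tIndex, hsub, e1]
    omega
  have hsum : ∑ i ∈ Icc y (#X.S), sub X.c X.S i = ∑ i ∈ X.S with r < i, X.c i := by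
    rw [sum_sub_eq X.c hy, hn]
    rfl
  have hle := card_filter_Icc_le X.s fun i => X.c (r + 1) < X.a i
  set M := #{i ∈ Icc 1 X.s | X.c (r + 1) < X.a i} with hM
  have hsplit : IsSplit X.s X.m X.a X.d p M := by
    refine ⟨hpm, hle, ?_, ?_⟩
    · rcases Nat.eq_zero_or_pos M with h0 | h0
      · exact Or.inl h0
      · have h1 := (X.ha.le_card_lt_iff h0 hle).1 hM.le
        by_cases hp : p = X.m
        · exact Or.inr (Or.inl hp)
        · have := hlow (p + 1) (by omega) (by omega)
          right; right; omega
    · by_cases hMs : M = X.s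
      · exact Or.inr (Or.inl hMs)
      · have h1 := mt (X.ha.le_card_lt_iff (v := X.c (r + 1)) (by omega : 1 ≤ M + 1)
          (by omega)).2 (by omega)
        rcases Nat.eq_zero_or_pos p with h0 | h0
        · exact Or.inl h0
        · have := hhigh p h0 le_rfl
          right; right; omega
  have htail := hsplit.tailSum_unionSeq X.ha X.hd
  rw [hz, hm, ht, hsum, hsetΔ, sum_Icc_succ_eq_tailSum]
  have e5 : (p : ℤ) + ((X.pos p (r + 1) : ℤ) - p) = X.pos p (r + 1) := by ring
  rw [e5, Int.toNat_natCast]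
  have e6 : ((X.pos p (r + 1) : ℤ) - p ≤ M) ↔ X.pos p (r + 1) ≤ p + M := by omega
  rw [e6]
  refine imp_congr_right fun hle' => ?_
  have e7 : ∑ x ∈ Icc (X.pos p (r + 1)) (p + M), unionSeq X.s X.m X.a X.d x
      + tailSum (X.m + X.s) X.union (p + M) = tailSum (X.m + X.s) X.union (X.pos p r) := by
    rw [tailSum, tailSum]
    have : Ioc (X.pos p r) (X.m + X.s)
        = Icc (X.pos p (r + 1)) (p + M) ∪ Ioc (p + M) (X.m + X.s) := by
      ext x
      simp only [mem_union, mem_Icc, mem_Ioc]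
      omega
    rw [this, sum_union]
    · rfl
    · rw [disjoint_left]
      intro x hx
      rw [mem_Icc] at hx
      rw [mem_Ioc]
      omega
  have e8 := X.sum_notMem_add p
  change tailSum (X.m + X.s) X.union (p + M) = _ at htail
  rw [total]
  constructor
  · rintro ⟨-, h1⟩
    linarith
  · intro h1
    -- Position P is filled by c_{r+1}, so P ≥ 1 and the convention e_i = +∞ for i ≤ 0 plays no
    -- role.
    exact ⟨by omega, by linarith⟩

end Run

theorem inequalities_iff_bounded (h : X.Run 0 0) :
    Inequalities X.s X.m X.a X.d X.c X.S X.Δ ↔ X.Bounded := by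
  constructor
  · intro hI p r hr hnext hlt hmem
    obtain ⟨y, hy, hn⟩ := exists_nth_eq hmem
    exact (hr.inequality_iff hlt hmem hnext hy hn).1 (hI y hy)
  · intro hB y hy
    have hmem := nth_mem_of_mem_Icc hy
    obtain ⟨r, hr⟩ : ∃ r, Nat.nth (· ∈ X.S) (y - 1) = r + 1 :=
      ⟨_, (Nat.sub_add_cancel (mem_Icc.1 (X.hS hmem)).1).symm⟩
    rw [hr] at hmem
    obtain ⟨p, h1, h2, h3, h4⟩ := h.exists_before_snd (Nat.succ_pos r) (mem_Icc.1 (X.hS hmem)).2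
    exact (h1.inequality_iff h3 hmem h2 hy hr).2 (hB p r h1 h2 h3 hmem)

end Config

/-! ### Necessity of the inequalities -/

section Levels

variable {m s : ℕ} {g d a : ℕ → ℤ}

theorem hIndex_spec (m : ℕ) (d g : ℕ → ℤ) {q : ℕ} (hq : 1 ≤ q) :
    q ≤ hIndex m d g q ∧ hIndex m d g q ≤ m + q ∧
      (m < hIndex m d g q + 1 - q ∨ d (hIndex m d g q + 1 - q) < g (hIndex m d g q)) := by
  have hmem : m + q ∈ {i : ℕ | 1 ≤ i ∧ q ≤ i ∧ (m < i + 1 - q ∨ d (i + 1 - q) < g i)} :=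
    ⟨by omega, by omega, Or.inl (by omega)⟩
  obtain ⟨-, h2, h3⟩ := Nat.sInf_mem ⟨_, hmem⟩
  exact ⟨h2, Nat.sInf_le hmem, h3⟩

theorem le_of_lt_hIndex {q x : ℕ} (hq : 1 ≤ q) (hqx : q ≤ x) (hx : x < hIndex m d g q) :
    x + 1 - q ≤ m ∧ g x ≤ d (x + 1 - q) := by
  have := Nat.notMem_of_lt_sInf hx
  simp only [Set.mem_ofPred_eq, not_and, not_or, not_lt] at this
  exact this (by omega) hqx

theorem hIndex_le {q x : ℕ} (hq : 1 ≤ q) (hqx : q ≤ x) (h : d (x + 1 - q) < g x) :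
    hIndex m d g q ≤ x :=
  Nat.sInf_le ⟨by omega, hqx, Or.inr h⟩

/-- Take r to be the largest index with h_r ≤ i, or 0. The inequality is part of the majorization at
h_r, and it persists up to i because h_{r+1} > i forces g_x ≤ d_{x-r} in between. -/
theorem WeakMaj.exists_level (hw : WeakMaj m s g d a) {i : ℕ} (hi : i ≤ m + s) :
    ∃ r ≤ s, r ≤ i ∧ i - r ≤ m ∧
      tailSum m d (i - r) + tailSum s a r ≤ tailSum (m + s) g i ∧
      ∀ q, 1 ≤ q → q ≤ s → q ≤ i → d (i + 1 - q) < g i → q ≤ r := by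
  classical
  obtain ⟨hw1, hw2, hw3⟩ := hw
  set r := Nat.findGreatest (fun r => r = 0 ∨ hIndex m d g r ≤ i) s with hr
  have hrs : r ≤ s := Nat.findGreatest_le s
  have hspec : r = 0 ∨ hIndex m d g r ≤ i :=
    Nat.findGreatest_spec (P := fun r => r = 0 ∨ hIndex m d g r ≤ i) (Nat.zero_le s) (Or.inl rfl)
  have hgr : ∀ q, r < q → q ≤ s → i < hIndex m d g q := fun q hq hqs => by
    have := Nat.findGreatest_is_greatest hq hqs
    omega
  obtain ⟨h, hrh, hhi, hhr, hbase⟩ : ∃ h, r ≤ h ∧ h ≤ i ∧ h - r ≤ m ∧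
      tailSum m d (h - r) + tailSum s a r ≤ tailSum (m + s) g h := by
    rcases Nat.eq_zero_or_pos r with h0 | h0
    · rw [h0]
      refine ⟨0, le_rfl, by omega, by omega, ?_⟩
      simpa only [← sum_Icc_succ_eq_tailSum] using hw3
    · obtain ⟨e1, e2, -⟩ := hIndex_spec m d g h0
      refine ⟨hIndex m d g r, e1, by omega, by omega, ?_⟩
      have := hw2 r (mem_Icc.2 ⟨h0, hrs⟩)
      rw [Nat.sub_add_comm e1] at this
      simpa only [sum_Icc_succ_eq_tailSum] using this
  have hstep : ∀ x, h < x → x ≤ i → x - r ≤ m ∧ g x ≤ d (x - r) := by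
    intro x hx hxi
    -- There is no h_{s+1}; for r = s the condition d_i ≥ g_{i+s} takes its place.
    rcases hrs.eq_or_lt with he | hlt
    · have := hw1 (x - s) (mem_Icc.2 ⟨by omega, by omega⟩)
      rw [Nat.sub_add_cancel (by omega)] at this
      rw [he]
      exact ⟨by omega, this⟩
    · have := le_of_lt_hIndex (by omega : 1 ≤ r + 1) (by omega : r + 1 ≤ x)
        (hxi.trans_lt (hgr (r + 1) (by omega) hlt))
      rwa [Nat.add_sub_add_right] at this
  have hind : ∀ x, h ≤ x → x ≤ i → x - r ≤ m ∧
      tailSum m d (x - r) + tailSum s a r ≤ tailSum (m + s) g x := by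
    intro x hx
    induction x, hx using Nat.le_induction with
    | base => exact fun _ => ⟨hhr, hbase⟩
    | succ x hx ih =>
      intro hxi
      obtain ⟨-, e2⟩ := ih (by omega)
      obtain ⟨e3, e4⟩ := hstep (x + 1) (by omega) hxi
      refine ⟨e3, ?_⟩
      rw [tailSum_of_lt g (by omega : x < m + s), tailSum_of_lt d (by omega : x - r < m)] at e2
      rw [Nat.sub_add_comm (by omega)] at e4 ⊢
      linarith
  obtain ⟨e1, e2⟩ := hind i hhi le_rfl
  refine ⟨r, hrs, by omega, e1, e2, fun q hq hqs hqi hlt => ?_⟩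
  by_contra hqr
  have h1 := hgr q (by omega) hqs
  have h2 := hIndex_le (m := m) hq hqi hlt
  omega

theorem WeakMaj.tailSum_unionSeq_le (ha : IsPartition s a) (hd : IsPartition m d)
    (hw : WeakMaj m s g d a) {i : ℕ} (hi : i ≤ m + s) :
    tailSum (m + s) (unionSeq s m a d) i ≤ tailSum (m + s) g i := by
  obtain ⟨r, hrs, hri, hirm, h, -⟩ := hw.exists_level hi
  have := GenMaj.tailSum_unionSeq_le ha hd hirm hrs
  rw [Nat.sub_add_cancel hri] at this
  exact this.trans h

end Levels

/-! ### Tail sums of a majorized partition along a run -/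

namespace Config

variable {X : Config}

/-- If the partition `g` is majorized and its tail sum is bounded by the sum of the chosen elements,
then its next entry is at most the next element chosen. -/
theorem Run.le_of_not_skip {p r : ℕ} {g : ℕ → ℤ} (h : X.Run p r) (hp : 1 ≤ p)
    (hw : WeakMaj X.m X.s g X.d X.a) (hs : ¬ X.Skip p r p)
    (hle : tailSum (X.m + X.s) g (X.pos p r) ≤ X.total p r) : g (X.pos p r) ≤ X.d p := by
  have h1 := Run.le_pos_of_not_skip hs
  have h2 := h.pos_le
  have h3 := h.pos_le_size
  have hpm := h.le_fst
  rcases h2.eq_or_lt with he | hlt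
  · rw [he]
    exact hw.1 p (mem_Icc.2 ⟨hp, hpm⟩)
  -- The level r' at P is at least q = P + 1 - p. The d_x with P - r' < x < p are at least d_p, and
  -- equally many a_x with q < x ≤ r' are below d_p, since q exceeds the rank of d_p. Exchanging
  -- them gives the inequality in `Skip`.
  · by_contra hg
    rw [Skip, not_or, not_and, not_le] at hs
    have h4 := hs.2 hlt
    obtain ⟨r', hr's, hr'i, hr'm, h5, h6⟩ := hw.exists_level h3
    have h7 : X.pos p r + 1 - (X.pos p r + 1 - p) = p := by omega
    have h8 := h6 (X.pos p r + 1 - p) (by omega) (by omega) (by omega) (by rw [h7]; omega)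
    have h9 := add_tailSum_le (w := X.m) (y := X.d) (v := X.d p) (i := X.pos p r - r')
      (j := p - 1) (by omega) (by omega) fun x hx hx' => X.hd.le (by omega) (by omega) hpm
    have h10 := tailSum_le_add (w := X.s) (y := X.a) (v := X.d p) h8 hr's fun x hx hx' => by
      have := mt (X.ha.le_card_le_iff (v := X.d p) (by omega : 1 ≤ x) (by omega)).2
        (by change ¬ x ≤ X.rank p; omega)
      omega
    rw [tailSum_of_lt X.d (by omega : p - 1 < X.m), Nat.sub_add_cancel hp] at h9
    have h11 : ((p - 1 : ℕ) : ℤ) - (X.pos p r - r' : ℕ)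
        = (r' : ℤ) - (X.pos p r + 1 - p : ℕ) := by omega
    rw [h11] at h9
    linarith

theorem Run.tailSum_le_total {p r : ℕ} {g : ℕ → ℤ} (h : X.Run p r)
    (hw : WeakMaj X.m X.s g X.d X.a) (hw' : WeakMaj X.n X.k g X.c X.b) :
    tailSum (X.m + X.s) g (X.pos p r) ≤ X.total p r := by
  induction h with
  | init => rw [pos_init, total_init, tailSum_of_le _ le_rfl]
  | @fst p r h0 h1 h2 ih =>
    by_cases hm : p + 1 ∈ X.Δ
    · have h3 := Run.le_pos_of_not_skip (h2.1 hm)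
      have h4 := h0.le_of_not_skip (by omega) hw (h2.1 hm) ih
      have h5 := h0.pos_le_size
      rw [pos_of_mem_Δ r hm, total_of_mem_Δ r hm, tailSum_of_lt g (by omega),
        Nat.sub_add_cancel (by omega)]
      linarith
    · rwa [pos_of_notMem_Δ r hm, total_of_notMem_Δ r hm]
  | @snd p r h0 h1 h2 ih =>
    by_cases hm : r + 1 ∈ X.S
    · have h3 := Run.le_pos_of_not_skip (h2.1 hm)
      have h4 := h0.swap.le_of_not_skip (g := g) (by omega) hw' (h2.1 hm)
        (by rw [pos_swap, total_swap, swap_m, swap_s, ← X.size]; exact ih)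
      have h5 := h0.pos_le_size
      rw [pos_swap] at h3 h4
      rw [swap_d] at h4
      rw [pos_of_mem_S p hm, total_of_mem_S p hm, tailSum_of_lt g (by omega),
        Nat.sub_add_cancel (by omega)]
      linarith
    · rwa [pos_of_notMem_S p hm, total_of_notMem_S p hm]

theorem bounded_of_weakMaj {g : ℕ → ℤ} (hw : WeakMaj X.m X.s g X.d X.a)
    (hw' : WeakMaj X.n X.k g X.c X.b) : X.Bounded := by
  intro p r _ h2 _ _ _
  exact (hw.tailSum_unionSeq_le X.ha X.hd h2.pos_le_size).trans (h2.tailSum_le_total hw hw')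

end Config

/-! ### Sufficiency of the inequalities -/

namespace Config

variable {X : Config}

namespace Run

variable {p r : ℕ}

/-- A chosen element that is at least the entry of e at P preserves the inequality. For d this
follows from not being skipped; for c it can fail only in the range where `Bounded` supplies the
inequality. -/
theorem tailSum_union_le_total (h : X.Run p r) (hX : X.Bounded) :
    tailSum (X.m + X.s) X.union (X.pos p r) ≤ X.total p r := by
  induction h with
  | init => rw [pos_init, total_init, tailSum_of_le _ le_rfl]
  | @fst p r h0 h1 h2 ih =>
    by_cases hm : p + 1 ∈ X.Δ
    · have h3 := le_pos_of_not_skip (h2.1 hm)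
      have h4 := h0.pos_le_size
      have h5 : X.union (X.pos (p + 1) r) ≤ X.d (p + 1) := by
        by_contra hlt
        have h6 := (lt_unionSeq_iff X.ha X.hd (by omega) h4 _).1 (not_le.1 hlt)
        have h7 : #{i ∈ Icc 1 X.s | X.d (p + 1) < X.a i} ≤ X.rank (p + 1) :=
          card_le_card fun i hi => by
            rw [mem_filter] at hi ⊢
            exact ⟨hi.1, hi.2.le⟩
        have h8 := mt (X.hd.le_card_lt_iff (v := X.d (p + 1)) (by omega : 1 ≤ p + 1)
          h0.le_fst).1 (lt_irrefl _)
        omega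
      rw [pos_of_mem_Δ r hm, total_of_mem_Δ r hm, tailSum_of_lt _ (by omega),
        Nat.sub_add_cancel (by omega)]
      linarith
    · rwa [pos_of_notMem_Δ r hm, total_of_notMem_Δ r hm]
  | @snd p r h0 h1 h2 ih =>
    by_cases hm : r + 1 ∈ X.S
    · by_cases hle : X.pos p (r + 1) ≤ p + #{i ∈ Icc 1 X.s | X.c (r + 1) < X.a i}
      · exact hX p r h0 (Run.snd h0 h1 h2) h1 hm hle
      · have h4 := h0.pos_le_size
        have h5 : X.union (X.pos p (r + 1)) ≤ X.c (r + 1) := by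
          by_contra hlt
          have h6 := (lt_unionSeq_iff X.ha X.hd (by omega) h4 _).1 (not_le.1 hlt)
          have h7 : ¬ p + 1 ≤ #{j ∈ Icc 1 X.m | X.c (r + 1) < X.d j} := by
            intro h8
            have h9 := h8.trans (card_filter_Icc_le _ _)
            rw [X.hd.le_card_lt_iff (by omega) h9] at h8
            have := h0.fst_lt_snd (lt_add_one p) h9 (by omega : 1 ≤ r + 1) le_rfl
            omega
          omega
        rw [pos_of_mem_S p hm, total_of_mem_S p hm, tailSum_of_lt _ (by omega),
          Nat.sub_add_cancel (by omega)]
        linarith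
    · rwa [pos_of_notMem_S p hm, total_of_notMem_S p hm]

theorem tailSum_add_le_total_of_le (h : X.Run p r) (hX : X.Bounded)
    (hpos : p + 1 ≤ X.pos p r) (hlt : X.a (X.pos p r - p) < X.d p)
    (hsp : p = X.m ∨ X.d (p + 1) ≤ X.a (X.pos p r - p)) :
    tailSum X.m X.d p + tailSum X.s X.a (X.pos p r - p) ≤ X.total p r := by
  have h1 := h.pos_le
  have hs : IsSplit X.s X.m X.a X.d p (X.pos p r - p) := by
    refine ⟨h.le_fst, by omega, Or.inr hsp, ?_⟩
    by_cases hq : X.pos p r - p = X.s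
    · exact Or.inr (Or.inl hq)
    · exact Or.inr (Or.inr ((X.ha.le (by omega) (by omega) (by omega)).trans_lt hlt))
  rw [← hs.tailSum_unionSeq X.ha X.hd, Nat.add_sub_cancel' (by omega)]
  exact h.tailSum_union_le_total hX

/-- If the next element of `d` is bigger than `a_Q`, where `Q` is the current level, then the sum of
the chosen elements is at least that of the treated elements of `d` and of `a_{Q+1}, …, a_s`. -/
theorem tailSum_add_le_total (h : X.Run p r) (hX : X.Bounded) (hp : 1 ≤ p)
    (hpos : p + 1 ≤ X.pos p r) (hlt : X.a (X.pos p r - p) < X.d p) :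
    tailSum X.m X.d p + tailSum X.s X.a (X.pos p r - p) ≤ X.total p r := by
  have hpm := h.le_fst
  by_cases hsp : p = X.m ∨ X.d (p + 1) ≤ X.a (X.pos p r - p)
  · exact h.tailSum_add_le_total_of_le hX hpos hlt hsp
  · rw [not_or, not_le] at hsp
    obtain ⟨hne, hlt'⟩ := hsp
    -- Induction along the run, from (p, P - p) back towards a split. A chosen d_{p+1} adds the same
    -- to both sides; if d_{p+1} was left out, the first alternative of `Skip` contradicts d_{p+1} >
    -- a_{P-p} and the second is the claim; a chosen c_{r+1} exceeds d_{p+1}, hence the additional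
    -- entry of a.
    induction h with
    | init => exact absurd rfl hne
    | @fst p r h0 h1 h2 ih =>
      by_cases hm : p + 1 ∈ X.Δ
      · have e1 := pos_of_mem_Δ r hm
        have e2 : X.pos (p + 1) r - (p + 1) = X.pos p r - p := by omega
        have h3 : tailSum X.m X.d (p + 1) + tailSum X.s X.a (X.pos p r - p)
            ≤ X.total (p + 1) r := by
          rw [← e2] at hlt' ⊢
          by_cases hsp : p + 1 = X.m ∨ X.d (p + 1 + 1) ≤ X.a (X.pos (p + 1) r - (p + 1))
          · exact h0.tailSum_add_le_total_of_le hX (by omega) hlt' hsp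
          · rw [not_or, not_le] at hsp
            exact ih (by omega) (by omega) hlt' h0.le_fst hsp.1 hsp.2
        rw [total_of_mem_Δ r hm, tailSum_of_lt X.d (by omega : p < X.m)]
        linarith
      · have hs : X.Skip (p + 1) r (p + 1) := not_not.1 (mt h2.2 hm)
        have e1 := pos_of_notMem_Δ r hm
        rw [e1] at hpos hlt hlt' ⊢
        have h3 := h0.pos_le
        rcases hs with hs | hs
        · have h4 := X.rank_le (p + 1)
          have h5 := (X.ha.le_card_le_iff (v := X.d (p + 1))
            (by omega : 1 ≤ X.pos (p + 1) r - p) (by omega)).1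
            (by change _ ≤ X.rank (p + 1); omega)
          omega
        · have h4 := hs.2
          rw [Nat.add_sub_add_right] at h4
          rw [total_of_notMem_Δ r hm, tailSum_of_lt X.d (by omega : p < X.m)]
          linarith
    | @snd p r h0 h1 h2 ih =>
      by_cases hm : r + 1 ∈ X.S
      · have e1 := pos_of_mem_S p hm
        have e2 : X.pos p (r + 1) - p = X.pos p r - p + 1 := by omega
        have h3 := h0.pos_le
        have h4 := X.ha.le (by omega : 1 ≤ X.pos p r - p)
          (by omega : X.pos p r - p ≤ X.pos p r - p + 1) (by omega)
        have h5 := ih hp (by omega) (by rw [e2]; omega) hpm hne (by rw [e2]; omega)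
        have h6 := h0.fst_lt_snd (lt_add_one p) (by omega) (by omega : 1 ≤ r + 1) le_rfl
        rw [e2] at h5
        rw [total_of_mem_S p hm, tailSum_of_lt X.a (by omega : X.pos p r - p < X.s)]
        linarith
      · have e1 := pos_of_notMem_S p hm
        rw [e1] at hpos hlt hlt' ⊢
        rw [total_of_notMem_S p hm]
        exact ih hp hpos hlt hpm hne hlt'

theorem fst_le_of_add_le {p' r' : ℕ} (h : X.Run p r) (h' : X.Run p' r') (he : p + r ≤ p' + r') :
    p ≤ p' := by
  by_contra hlt
  have h1 := h'.fst_lt_snd (i := p) (l := r') (by omega) h.le_fst (by omega) le_rfl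
  have h2 := h.snd_lt_fst (i := p) (l := r') (by omega) h'.le_snd (by omega) le_rfl
  omega

theorem snd_le_of_add_le {p' r' : ℕ} (h : X.Run p r) (h' : X.Run p' r') (he : p + r ≤ p' + r') :
    r ≤ r' :=
  h.swap.fst_le_of_add_le h'.swap (by omega)

/-- The last free position drops by at most one in each step, so no value is passed over. -/
theorem exists_pos_eq (h : X.Run p r) {i : ℕ} (hi : X.pos p r ≤ i) (him : i ≤ X.m + X.s) :
    ∃ p' r', X.Run p' r' ∧ X.pos p' r' = i := by
  induction h with
  | init =>
    rw [pos_init] at hi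
    exact ⟨_, _, Run.init, by rw [pos_init]; omega⟩
  | @fst p r h0 h1 h2 ih =>
    by_cases he : X.pos p r = i
    · exact ⟨p, r, Run.fst h0 h1 h2, he⟩
    · by_cases hm : p + 1 ∈ X.Δ
      · rw [pos_of_mem_Δ r hm] at hi he
        exact ih (by omega)
      · rw [pos_of_notMem_Δ r hm] at hi
        exact ih hi
  | @snd p r h0 h1 h2 ih =>
    by_cases he : X.pos p r = i
    · exact ⟨p, r, Run.snd h0 h1 h2, he⟩
    · by_cases hm : r + 1 ∈ X.S
      · rw [pos_of_mem_S p hm] at hi he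
        exact ih (by omega)
      · rw [pos_of_notMem_S p hm] at hi
        exact ih hi

end Run

/-! ### Construction of the partition G -/

theorem pos_mono {p r p' r' : ℕ} (hp : p ≤ p') (hr : r ≤ r') : X.pos p r ≤ X.pos p' r' := by
  have h1 : #{i ∈ X.S | r' < i} ≤ #{i ∈ X.S | r < i} :=
    card_le_card (monotone_filter_right _ fun _ _ h => hr.trans_lt h)
  have h2 : #{i ∈ X.Δ | p' < i} ≤ #{i ∈ X.Δ | p < i} :=
    card_le_card (monotone_filter_right _ fun _ _ h => hp.trans_lt h)
  rw [pos, pos, chosen, chosen]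
  omega

/-- At the stage `(p, r)`, all chosen elements of `c` and `d` are at most the `x`-th entry of `G`
if the position `x` is free, and all others are at least that entry if it is occupied. -/
structure Separates (X : Config) (G : ℕ → ℤ) (p r : ℕ) : Prop where
  sum_eq : tailSum (X.m + X.s) G (X.pos p r) = X.total p r
  d_le : ∀ x, 1 ≤ x → x ≤ X.pos p r → ∀ i, p < i → i ≤ X.m → X.d i ≤ G x
  c_le : ∀ x, 1 ≤ x → x ≤ X.pos p r → ∀ l, r < l → l ≤ X.n → X.c l ≤ G x
  le_d : ∀ x, X.pos p r < x → x ≤ X.m + X.s → ∀ i, 1 ≤ i → i ≤ p → G x ≤ X.d i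
  le_c : ∀ x, X.pos p r < x → x ≤ X.m + X.s → ∀ l, 1 ≤ l → l ≤ r → G x ≤ X.c l

theorem Separates.swap {G : ℕ → ℤ} {p r : ℕ} (h : X.Separates G p r) : X.swap.Separates G r p := by
  constructor
  · rw [pos_swap, total_swap, swap_m, swap_s, ← X.size]
    exact h.sum_eq
  · rw [pos_swap]
    exact h.c_le
  · rw [pos_swap]
    exact h.d_le
  · rw [pos_swap, swap_m, swap_s, ← X.size]
    exact h.le_c
  · rw [pos_swap, swap_m, swap_s, ← X.size]
    exact h.le_d

/-- The partition `G` has the chosen elements in the occupied positions and `B` in the free ones. -/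
structure Fills (X : Config) (B : ℤ) (G : ℕ → ℤ) (p r : ℕ) : Prop where
  top : ∀ x, 1 ≤ x → x ≤ X.pos p r → G x = B
  isPartition : IsPartition (X.m + X.s) G
  separates : ∀ p' r', X.Run p' r' → p + r ≤ p' + r' → X.Separates G p' r'

theorem Fills.swap {B : ℤ} {G : ℕ → ℤ} {p r : ℕ} (h : X.Fills B G p r) :
    X.swap.Fills B G r p := by
  constructor
  · rw [pos_swap]
    exact h.top
  · rw [swap_m, swap_s, ← X.size]
    exact h.isPartition
  · intro r' p' hr hle
    exact (h.separates p' r' hr.swap (by omega)).swap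

/-- Only the last free position is overwritten. It was free at all earlier stages too, so their tail
sums do not change, and `Separates.le_d` keeps the sequence nonincreasing. -/
theorem Fills.fst_step {B : ℤ} {p r : ℕ} (hBd : ∀ i, 1 ≤ i → i ≤ X.m → X.d i ≤ B)
    (hBc : ∀ l, 1 ≤ l → l ≤ X.n → X.c l ≤ B) {G : ℕ → ℤ} (hG : X.Fills B G (p + 1) r)
    (h0 : X.Run (p + 1) r) (h1 : r = 0 ∨ X.d (p + 1) < X.c r)
    (h2 : p + 1 ∈ X.Δ ↔ ¬ X.Skip (p + 1) r (p + 1)) : ∃ G', X.Fills B G' p r := by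
  have hnew := Run.fst h0 h1 h2
  have hpm := h0.le_fst
  have hsep := hG.separates _ _ h0 le_rfl
  have huniq : ∀ p' r', X.Run p' r' → p + r ≤ p' + r' →
      (p + 1 + r ≤ p' + r') ∨ (p' = p ∧ r' = r) := by
    intro p' r' hr hle
    by_cases he : p + r = p' + r'
    · have := hnew.unique_fst hr he
      right; omega
    · left; omega
  by_cases hm : p + 1 ∈ X.Δ
  · have hpos := pos_of_mem_Δ r hm
    have h3 := Run.le_pos_of_not_skip (h2.1 hm)
    have h4 := h0.pos_le_size
    set P := X.pos (p + 1) r with hP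
    have hval : ∀ x, x ≠ P → Function.update G P (X.d (p + 1)) x = G x := fun x hx =>
      Function.update_of_ne hx _ _
    have hvalP : Function.update G P (X.d (p + 1)) P = X.d (p + 1) := Function.update_self ..
    have htail : ∀ x, P ≤ x → tailSum (X.m + X.s) (Function.update G P (X.d (p + 1))) x
        = tailSum (X.m + X.s) G x := fun x hx => sum_congr rfl fun z hz => hval z (by
          rw [mem_Ioc] at hz; omega)
    have hdB := hBd (p + 1) (by omega) hpm
    refine ⟨Function.update G P (X.d (p + 1)), ?_, ?_, ?_⟩
    · intro x hx hxP
      rw [hval x (by omega)]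
      exact hG.top x hx (by omega)
    · intro x hx y hy hxy
      rw [Set.mem_Icc] at hx hy
      rcases lt_trichotomy y P with hy' | hy' | hy'
      · rw [hval x (by omega), hval y (by omega)]
        exact hG.isPartition.le hx.1 hxy hy.2
      · rw [hy', hvalP]
        rcases hxy.eq_or_lt with he | hlt
        · rw [he, hy', hvalP]
        · rw [hval x (by omega), hG.top x hx.1 (by omega)]
          exact hdB
      · rw [hval y (by omega)]
        by_cases hxP : x = P
        · rw [hxP, hvalP]
          exact hsep.le_d y hy' hy.2 _ (by omega) le_rfl
        · rw [hval x hxP]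
          exact hG.isPartition.le hx.1 hxy hy.2
    · intro p' r' hr hle
      rcases huniq p' r' hr hle with hle' | ⟨rfl, rfl⟩
      · have hs := hG.separates p' r' hr hle'
        have hp' := h0.fst_le_of_add_le hr hle'
        have hr' := h0.snd_le_of_add_le hr hle'
        have hpos' : P ≤ X.pos p' r' := pos_mono hp' hr'
        constructor
        · rw [htail _ hpos']
          exact hs.sum_eq
        · intro x hx hxP i hi him
          by_cases hxe : x = P
          · rw [hxe, hvalP]
            exact X.hd.le (by omega) (by omega) him
          · rw [hval x hxe]
            exact hs.d_le x hx hxP i hi him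
        · intro x hx hxP i hi him
          by_cases hxe : x = P
          · rw [hxe, hvalP]
            exact (h0.snd_lt_fst (by omega) him (by omega) le_rfl).le
          · rw [hval x hxe]
            exact hs.c_le x hx hxP i hi him
        · intro x hx
          rw [hval x (by omega)]
          exact hs.le_d x hx
        · intro x hx
          rw [hval x (by omega)]
          exact hs.le_c x hx
      · constructor
        · rw [hpos, tailSum_of_lt _ (by omega), Nat.sub_add_cancel (by omega), hvalP,
            htail P le_rfl, total_of_mem_Δ r' hm, hsep.sum_eq, add_comm]
        · intro x hx hxP i hi him
          rw [hval x (by omega), hG.top x hx (by omega)]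
          exact hBd i (by omega) him
        · intro x hx hxP i hi him
          rw [hval x (by omega), hG.top x hx (by omega)]
          exact hBc i (by omega) him
        · intro x hx hxm i hi him
          by_cases hxe : x = P
          · rw [hxe, hvalP]
            exact X.hd.le hi (by omega) hpm
          · rw [hval x hxe]
            exact hsep.le_d x (by omega) hxm i hi (by omega)
        · intro x hx hxm i hi him
          by_cases hxe : x = P
          · rw [hxe, hvalP]
            rcases h1 with h1 | h1
            · omega
            · exact (h1.trans_le (X.hc.le hi him h0.le_snd)).le
          · rw [hval x hxe]
            exact hsep.le_c x (by omega) hxm i hi him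
  · have hpos := pos_of_notMem_Δ r hm
    refine ⟨G, ?_, hG.isPartition, ?_⟩
    · rw [hpos]
      exact hG.top
    · intro p' r' hr hle
      rcases huniq p' r' hr hle with hle' | ⟨rfl, rfl⟩
      · exact hG.separates p' r' hr hle'
      · constructor
        · rw [hpos, total_of_notMem_Δ r' hm]
          exact hsep.sum_eq
        · rw [hpos]
          intro x hx hxP i hi him
          rw [hG.top x hx hxP]
          exact hBd i (by omega) him
        · rw [hpos]
          exact hsep.c_le
        · rw [hpos]
          exact fun x hx hxm i hi hip => hsep.le_d x hx hxm i hi (by omega)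
        · rw [hpos]
          exact hsep.le_c

theorem Run.exists_fills {B : ℤ} (hBd : ∀ i, 1 ≤ i → i ≤ X.m → X.d i ≤ B)
    (hBc : ∀ l, 1 ≤ l → l ≤ X.n → X.c l ≤ B) {p r : ℕ} (h : X.Run p r) :
    ∃ G, X.Fills B G p r := by
  induction h with
  | init =>
    refine ⟨fun _ => B, fun _ _ _ => rfl, fun _ _ _ _ _ => le_rfl, fun p' r' hr hle => ?_⟩
    have hp := hr.le_fst
    have hn := hr.le_snd
    obtain rfl : p' = X.m := by omega
    obtain rfl : r' = X.n := by omega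
    constructor
    · rw [pos_init, total_init, tailSum_of_le _ le_rfl]
    · intros; omega
    · intros; omega
    · rw [pos_init]; intros; omega
    · rw [pos_init]; intros; omega
  | fst h0 h1 h2 ih =>
    obtain ⟨G, hG⟩ := ih
    exact hG.fst_step hBd hBc h0 h1 h2
  | snd h0 h1 h2 ih =>
    obtain ⟨G, hG⟩ := ih
    obtain ⟨G', hG'⟩ := hG.swap.fst_step hBc hBd h0.swap h1 h2
    exact ⟨G', hG'.swap⟩

/-! ### Majorization of G -/

theorem Fills.weakMaj {B : ℤ} {G : ℕ → ℤ} (hG : X.Fills B G 0 0) (h : X.Run 0 0)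
    (hX : X.Bounded) (hB0 : 0 ≤ B)
    (hB : ∀ x ≤ X.m, ∀ q ≤ X.s, tailSum X.m X.d x + tailSum X.s X.a q ≤ B + X.total 0 0) :
    WeakMaj X.m X.s G X.d X.a := by
  have hsize := h.pos_le_size
  have htop : ∀ i, i < X.pos 0 0 → B + X.total 0 0 ≤ tailSum (X.m + X.s) G i := by
    intro i hi
    have h1 := add_tailSum_le (y := G) (v := B) hi.le hsize
      fun x hx hx' => (hG.top x (by omega) hx').ge
    rw [(hG.separates 0 0 h le_rfl).sum_eq] at h1
    -- At least one position beyond i carries B, and further ones do no harm as B ≥ 0.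
    have h2 : (1 : ℤ) * B ≤ ((X.pos 0 0 : ℤ) - i) * B :=
      mul_le_mul_of_nonneg_right (by omega) hB0
    linarith
  have hsplit : ∀ x q, IsSplit X.s X.m X.a X.d x q →
      tailSum X.m X.d x + tailSum X.s X.a q ≤ tailSum (X.m + X.s) G (x + q) := by
    intro x q hs
    by_cases hlt : x + q < X.pos 0 0
    · exact (hB x hs.1 q hs.2.1).trans (htop _ hlt)
    · have hx := hs.1
      have hq := hs.2.1
      obtain ⟨p, r, hr, hpos⟩ := h.exists_pos_eq (i := x + q) (by omega) (by omega)
      have h1 := hr.tailSum_union_le_total hX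
      rw [← (hG.separates p r hr (by omega)).sum_eq, hpos] at h1
      rwa [← hs.tailSum_unionSeq X.ha X.hd]
  have hinserted : ∀ j r, 1 ≤ j → X.Run j r → X.Run (j - 1) r → j ∈ X.Δ →
      ¬ X.Skip j r j → G (X.pos j r) = X.d j := by
    intro j r hj h1 h2 hm hs
    obtain ⟨j, rfl⟩ : ∃ i, j = i + 1 := ⟨j - 1, by omega⟩
    have h3 := Run.le_pos_of_not_skip hs
    have h4 := h1.pos_le_size
    have e1 := (hG.separates _ _ h1 (by omega)).sum_eq
    have e2 := (hG.separates _ _ h2 (by omega)).sum_eq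
    rw [Nat.add_sub_cancel, pos_of_mem_Δ r hm, total_of_mem_Δ r hm, tailSum_of_lt _ (by omega),
      Nat.sub_add_cancel (by omega)] at e2
    linarith
  refine ⟨fun i hi => ?_, fun q hq => ?_, ?_⟩
  · rw [mem_Icc] at hi
    obtain ⟨r, h1, h2, -, h4⟩ := h.exists_before_fst (j := i) (by omega) hi.2
    rcases h1.pos_le.eq_or_lt with he | hlt
    · have hs : ¬ X.Skip i r i := by
        rintro (hs | hs)
        · have := X.rank_le i
          omega
        · omega
      rw [← he, hinserted i r hi.1 h1 h2 (h4.2 hs) hs]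
    · exact (hG.separates i r h1 (by omega)).le_d _ hlt (by omega) i hi.1 le_rfl
  · rw [mem_Icc] at hq
    obtain ⟨e1, e2, e3⟩ := hIndex_spec X.m X.d G hq.1
    have hbelow : ∀ x, q ≤ x → x < hIndex X.m X.d G q → x + 1 - q ≤ X.m ∧ G x ≤ X.d (x + 1 - q) :=
      fun x hqx hx => le_of_lt_hIndex hq.1 hqx hx
    set i := hIndex X.m X.d G q with hi
    rw [Nat.sub_add_comm e1, sum_Icc_succ_eq_tailSum, sum_Icc_succ_eq_tailSum,
      sum_Icc_succ_eq_tailSum]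
    have hx0 := card_filter_Icc_le X.m fun j => X.a q < X.d j
    have hx0' : ∀ {x}, 1 ≤ x → x ≤ X.m →
        (x ≤ #{j ∈ Icc 1 X.m | X.a q < X.d j} ↔ X.a q < X.d x) := X.hd.le_card_lt_iff
    set x₀ := #{j ∈ Icc 1 X.m | X.a q < X.d j}
    -- (x₀, q) is the split of e just after a_q. If it lies at or before h_q, the inequality there
    -- is carried on to h_q, using G_{x+1} ≤ G_x ≤ d_{x+1-q} for x < h_q.
    by_cases hle : x₀ + q ≤ i
    · have hs : IsSplit X.s X.m X.a X.d x₀ q := by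
        refine ⟨hx0, hq.2, ?_, ?_⟩
        · by_cases hxm : x₀ = X.m
          · exact Or.inr (Or.inl hxm)
          · have := mt (hx0' (by omega : 1 ≤ x₀ + 1) (by omega)).2 (by omega)
            right; right; omega
        · rcases Nat.eq_zero_or_pos x₀ with h0 | h0
          · exact Or.inl h0
          · by_cases hqs : q = X.s
            · exact Or.inr (Or.inl hqs)
            · have h1 := (hx0' h0 hx0).1 le_rfl
              exact Or.inr (Or.inr ((X.ha.le hq.1 (by omega) (by omega)).trans_lt h1))
      have hind : ∀ x, x₀ + q ≤ x → x ≤ i →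
          tailSum X.m X.d (x - q) + tailSum X.s X.a q ≤ tailSum (X.m + X.s) G x := by
        intro x hx
        induction x, hx using Nat.le_induction with
        | base =>
          intro _
          rw [Nat.add_sub_cancel]
          exact hsplit _ _ hs
        | succ x hx ih =>
          intro hxi
          have h1 := ih (by omega)
          obtain ⟨h2, h3⟩ := hbelow x (by omega) (by omega)
          have h4 := hG.isPartition.le (by omega : 1 ≤ x) (by omega : x ≤ x + 1) (by omega)
          rw [Nat.sub_add_comm (by omega)] at h2 h3
          rw [tailSum_of_lt G (by omega), tailSum_of_lt X.d (by omega : x - q < X.m)] at h1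
          rw [Nat.sub_add_comm (by omega)]
          linarith
      exact hind i hle le_rfl
    -- Otherwise a_q < d_j < G_i for i = h_q. At the stage treating d_j the entries of G from i + 1
    -- to P are at least d_j, so it remains to bound T from below.
    · obtain ⟨j, hj⟩ : ∃ j, j = i + 1 - q := ⟨_, rfl⟩
      rw [← hj] at e3
      have hjm : j ≤ X.m := by omega
      have hdj : X.d j < G i := by omega
      have haj : X.a q < X.d j := (hx0' (by omega) hjm).1 (by omega)
      have haj' : ∀ x, q < x → x ≤ X.s → X.a x ≤ X.d j := fun x hx hxs =>
        (X.ha.le hq.1 hx.le hxs).trans haj.le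
      obtain ⟨r, h1, h2, -, h4⟩ := h.exists_before_fst (j := j) (by omega) hjm
      have hsep := hG.separates j r h1 (by omega)
      have hps := h1.pos_le_size
      have hpl := h1.pos_le
      have hiP : i ≤ X.pos j r := by
        by_contra hlt
        have := hsep.le_d i (by omega) (by omega) j (by omega) le_rfl
        omega
      have hge : ∀ x, i < x → x ≤ X.pos j r → X.d j ≤ G x := by
        intro x hx hxP
        have hsep' := hG.separates (j - 1) r h2 (by omega)
        by_cases hm : j ∈ X.Δ
        · by_cases hxe : x = X.pos j r
          · rw [hxe, hinserted j r (by omega) h1 h2 hm (h4.1 hm)]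
          · have hpos := pos_of_mem_Δ (p := j - 1) r (by rwa [Nat.sub_add_cancel (by omega)])
            rw [Nat.sub_add_cancel (by omega)] at hpos
            exact hsep'.d_le x (by omega) (by omega) j (by omega) hjm
        · have hpos := pos_of_notMem_Δ (p := j - 1) r (by rwa [Nat.sub_add_cancel (by omega)])
          rw [Nat.sub_add_cancel (by omega)] at hpos
          exact hsep'.d_le x (by omega) (by omega) j (by omega) hjm
      have h5 := add_tailSum_le hiP hps hge
      rw [hsep.sum_eq] at h5
      rw [show i - q = j - 1 by omega, tailSum_of_lt X.d (by omega : j - 1 < X.m),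
        Nat.sub_add_cancel (by omega)]
      by_cases hm : j ∈ X.Δ
      · have hne : i ≠ X.pos j r := by
          intro he
          rw [he, hinserted j r (by omega) h1 h2 hm (h4.1 hm)] at hdj
          exact lt_irrefl _ hdj
        have h6 := h1.tailSum_add_le_total hX (by omega) (by omega)
          ((X.ha.le hq.1 (by omega) (by omega)).trans_lt haj)
        have h7 := tailSum_le_add (w := X.s) (y := X.a) (v := X.d j)
          (by omega : q ≤ X.pos j r - j) (by omega) fun x hx hx' => haj' x hx (by omega)
        -- One copy of d_j more than is needed to dominate a_{q+1}, …, a_{P-j}; it accounts for the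
        -- summand d_j itself.
        have h8 : (X.pos j r : ℤ) - i = ((X.pos j r - j : ℕ) : ℤ) - q + 1 := by omega
        rw [h8] at h5
        linarith
      · have hs : X.Skip j r j := not_not.1 (mt h4.2 hm)
        rcases hs with hs | hs
        · have h6 := X.rank_le j
          have h7 := (X.ha.le_card_le_iff (v := X.d j) hq.1 hq.2).1
            (by change _ ≤ X.rank j; omega)
          omega
        · have h6 := tailSum_le_add (w := X.s) (y := X.a) (v := X.d j)
            (by omega : q ≤ X.pos j r + 1 - j) (by omega) fun x hx hx' => haj' x hx (by omega)
          have h7 : (X.pos j r : ℤ) - i = ((X.pos j r + 1 - j : ℕ) : ℤ) - q := by omega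
          rw [h7] at h5
          linarith [hs.2]
  · have h1 := hsplit 0 0 (by simp [IsSplit])
    simpa only [← sum_Icc_succ_eq_tailSum] using h1

theorem exists_weakMaj (h : X.Run 0 0) (hX : X.Bounded) (hX' : X.swap.Bounded) :
    ∃ g, IsPartition (X.m + X.s) g ∧ WeakMaj X.m X.s g X.d X.a ∧ WeakMaj X.n X.k g X.c X.b := by
  -- B has to dominate 0, all entries of c and d, and the finitely many combined tail sums of both
  -- pairs minus the final total.
  obtain ⟨B, hB⟩ := Finset.exists_le
    ({0} ∪ (Icc 1 X.m).image X.d ∪ (Icc 1 X.n).image X.c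
      ∪ (range (X.m + 1) ×ˢ range (X.s + 1)).image
        (fun x => tailSum X.m X.d x.1 + tailSum X.s X.a x.2 - X.total 0 0)
      ∪ (range (X.n + 1) ×ˢ range (X.k + 1)).image
        (fun x => tailSum X.n X.c x.1 + tailSum X.k X.b x.2 - X.total 0 0))
  simp only [mem_union, mem_singleton, mem_image, mem_product, mem_range, mem_Icc] at hB
  have hB0 : 0 ≤ B := hB 0 (by simp)
  have hBd : ∀ i, 1 ≤ i → i ≤ X.m → X.d i ≤ B := fun i h1 h2 =>
    hB _ (Or.inl (Or.inl (Or.inl (Or.inr ⟨i, ⟨h1, h2⟩, rfl⟩))))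
  have hBc : ∀ i, 1 ≤ i → i ≤ X.n → X.c i ≤ B := fun i h1 h2 =>
    hB _ (Or.inl (Or.inl (Or.inr ⟨i, ⟨h1, h2⟩, rfl⟩)))
  obtain ⟨G, hG⟩ := h.exists_fills hBd hBc
  refine ⟨G, hG.isPartition, hG.weakMaj h hX hB0 fun x hx q hq => ?_,
    hG.swap.weakMaj h.swap hX' hB0 fun x hx q hq => ?_⟩
  · have := hB _ (Or.inl (Or.inr ⟨(x, q), ⟨by simp only; omega, by simp only; omega⟩, rfl⟩))
    linarith
  · rw [swap_m] at hx
    rw [swap_s] at hq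
    have := hB _ (Or.inr ⟨(x, q), ⟨by simp only; omega, by simp only; omega⟩, rfl⟩)
    rw [total_swap]
    simp only [swap_m, swap_d, swap_s, swap_a]
    linarith

end Config

end GenMaj

/-- Here `a = (a_1, …, a_s)`, `d = (d_1, …, d_m)`, `b = (b_1, …, b_k)`, `c = (c_1, …, c_n)`. -/
theorem theorem1 (m s n k : ℕ) (hmsnk : m + s = n + k) (a d b c : ℕ → ℤ)
    (ha : GenMaj.IsPartition s a) (hd : GenMaj.IsPartition m d)
    (hb : GenMaj.IsPartition k b) (hc : GenMaj.IsPartition n c)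
    (hcd : ∀ i ∈ Finset.Icc 1 n, ∀ j ∈ Finset.Icc 1 m, c i ≠ d j) :
    (∃ g : ℕ → ℤ, GenMaj.IsPartition (m + s) g ∧
        GenMaj.WeakMaj m s g d a ∧ GenMaj.WeakMaj n k g c b) ↔
      (GenMaj.Inequalities s m a d c
          (GenMaj.setS m s n k a d b c) (GenMaj.setΔ m s n k a d b c) ∧
        GenMaj.Inequalities k n b c d
          (GenMaj.setΔ m s n k a d b c) (GenMaj.setS m s n k a d b c)) := by
  have hrun := GenMaj.run_configOf hmsnk ha hd hb hc hcd
  have h1 := GenMaj.Config.inequalities_iff_bounded hrun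
  have h2 := GenMaj.Config.inequalities_iff_bounded hrun.swap
  constructor
  · rintro ⟨g, hg, hw, hw'⟩
    refine ⟨h1.2 (GenMaj.Config.bounded_of_weakMaj hw hw'),
      h2.2 (GenMaj.Config.bounded_of_weakMaj hw' hw)⟩
  · rintro ⟨hI, hI'⟩
    exact GenMaj.Config.exists_weakMaj hrun (h1.1 hI) (h2.1 hI')
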